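/- **Setting.** Let $k$ be an algebraically closed field. A *finite $k$-linear category* is an abelian $k$-linear category that is $k$-linearly equivalent to the category of finite-dimensional modules over a finite-dimensional $k$-algebra. A *finite tensor category* is a finite $k$-linear category with a rigid monoidal structure whose tensor product is $k$-bilinear and whose unit $\mathbf 1$ is simple. A *finite module category* (finite $\mathcal C$-module) over a finite tensor category $\mathcal C$ is a finite $k$-linear category with a left action $(c,m)\mapsto c.m$ of $\mathcal C$ that is $k$-bilinear, exact in the first variable and right exact in the second. Right duals $c^\vee$ come with $c^\vee\otimes c\to\mathbf 1$ and $\mathbf 1\to c\otimes c^\vee$; left duals ${}^\vee c$ with $c\otimes{}^\vee c\to\mathbf 1$ and $\mathbf 1\to{}^\vee c\otimes c$. Associators are suppressed. A half-braiding on $x\in\mathcal C$ is a natural family of isomorphisms $\beta_c\colon x\otimes c\to c\otimes x$ with $\beta_{c\otimes c'}=(\mathrm{id}_c\otimes\beta_{c'})\circ(\beta_c\otimes\mathrm{id}_{c'})$. The Drinfeld center $\mathcal Z(\mathcal C)$ has as objects the pairs $z=(x,\beta)$, and as morphisms the morphisms of $\mathcal C$ compatible with the half-braidings. For finite $\mathcal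 C$-modules $\mathcal M,\mathcal N$ let $\mathcal Rex_{\mathcal C}(\mathcal M,\mathcal N)$ be the category of right exact $k$-linear module functors $F\colon\mathcal M\to\mathcal N$ (with constraints $F(c.m)\cong c.F(m)$) and module natural transformations. It is a $\mathcal Z(\mathcal C)$-module category: for $z=(x,\beta)$ the functor $z.F$ sends $m$ to $x.F(m)$, with constraint $x.F(c.m)\cong (x\otimes c).F(m)\xrightarrow{\beta_c.F(m)}(c\otimes x).F(m)\cong c.(x.F(m))$. For a monoidal category $\mathcal A$ and a left $\mathcal A$-module category $\mathcal X$, an internal Hom of $\mathcal X$ is a functor $\underline{\mathrm{Hom}}\colon\mathcal X^{\mathrm{op}}\times\mathcal X\to\mathcal A$ with natural bijections $\mathrm{Hom}_{\mathcal A}(a,\underline{\mathrm{Hom}}(x,x'))\cong\mathrm{Hom}_{\mathcal X}(a.x,x')$, and an internal coHom is a functor $\underline{\mathrm{coHom}}\colon\mathcal X^{\mathrm{op}}\times\mathcal X\to\mathcal A$ with natural bijections $\mathrm{Hom}_{\mathcal A}(\underline{\mathrm{coHom}}(x',x),a)\cong\mathrm{Hom}_{\mathcal X}(x,a.x')$.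 For $\mathcal A=\mathcal Z(\mathcal C)$ and $\mathcal X=\mathcal Rex_{\mathcal C}(\mathcal M,\mathcal N)$ these are denoted $\underline{\mathrm{Nat}}$ and $\underline{\mathrm{coNat}}$. For $\mathcal A=\mathcal C$ and $\mathcal X=\mathcal N$, the defining bijections and duality give canonical isomorphisms $\underline{\mathrm{Hom}}_{\mathcal N}(c.n,c'.n')\cong c'\otimes\underline{\mathrm{Hom}}_{\mathcal N}(n,n')\otimes c^\vee$ and $c'\otimes\underline{\mathrm{coHom}}_{\mathcal N}(n',n)\otimes{}^\vee c\cong\underline{\mathrm{coHom}}_{\mathcal N}(c.n',c'.n)$. Combined with the constraints of $F,G\in\mathcal Rex_{\mathcal C}(\mathcal M,\mathcal N)$ they yield isomorphisms $$\varphi_{c,m}\colon\underline{\mathrm{Hom}}_{\mathcal N}(F(c.m),G(c.m))\to c\otimes\underline{\mathrm{Hom}}_{\mathcal N}(F(m),G(m))\otimes c^\vee,$$ $$\psi_{c,m}\colon c\otimes\underline{\mathrm{coHom}}_{\mathcal N}(F(m),G(m))\otimes{}^\vee c\to\underline{\mathrm{coHom}}_{\mathcal N}(F(c.m),G(c.m)).$$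 **Theorem.** Let $\mathcal C$ be a finite tensor category over $k$ and let $\mathcal M,\mathcal N$ be finite $\mathcal C$-modules. Then $\mathcal N$ has an internal Hom and an internal coHom in $\mathcal C$, and $\mathcal Rex_{\mathcal C}(\mathcal M,\mathcal N)$ has an internal Hom $\underline{\mathrm{Nat}}$ and an internal coHom $\underline{\mathrm{coNat}}$ in $\mathcal Z(\mathcal C)$. For any choice of these and all $F,G\in\mathcal Rex_{\mathcal C}(\mathcal M,\mathcal N)$: (i) The end $g=\int_{m\in\mathcal M}\underline{\mathrm{Hom}}_{\mathcal N}(F(m),G(m))$ exists in $\mathcal C$; let $j_m$ be its structure morphisms. There is exactly one half-braiding $\beta$ on $g$ (central integration) such that, with $\delta_c\colon g\to c\otimes g\otimes c^\vee$ the morphism corresponding to $\beta_c\colon g\otimes c\to c\otimes g$ under duality, $$(\mathrm{id}_c\otimes j_m\otimes\mathrm{id}_{c^\vee})\circ\delta_c=\varphi_{c,m}\circ j_{c.m}\qquad\text{for all }c\in\mathcal C,\ m\in\mathcal M.$$ There is exactly one isomorphism $e\colon\underline{\mathrm{Nat}}(F,G)\to(g,\beta)$ in $\mathcal Z(\mathcal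 C)$ such that for all $z=(x,\gamma)\in\mathcal Z(\mathcal C)$, $f\colon z\to\underline{\mathrm{Nat}}(F,G)$ and $m\in\mathcal M$, the morphism $j_m\circ e\circ f\colon x\to\underline{\mathrm{Hom}}_{\mathcal N}(F(m),G(m))$ corresponds to the component $\eta_m\colon x.F(m)\to G(m)$ of the module natural transformation $\eta\colon z.F\to G$ that corresponds to $f$. Thus $$\underline{\mathrm{Nat}}(F,G)\cong\int_{m\in\mathcal M}\underline{\mathrm{Hom}}_{\mathcal N}(F(m),G(m))\quad\text{canonically in }\mathcal Z(\mathcal C).$$ (ii) The coend $h=\int^{m\in\mathcal M}\underline{\mathrm{coHom}}_{\mathcal N}(F(m),G(m))$ exists in $\mathcal C$; let $i_m$ be its structure morphisms. There is exactly one half-braiding $\beta$ on $h$ such that, with $\rho_c\colon c\otimes h\otimes{}^\vee c\to h$ the morphism corresponding to $\beta_c^{-1}\colon c\otimes h\to h\otimes c$ under duality, $$\rho_c\circ(\mathrm{id}_c\otimes i_m\otimes\mathrm{id}_{{}^\vee c})=i_{c.m}\circ\psi_{c,m}\qquad\text{for all }c\in\mathcal C,\ m\in\mathcal M.$$ There is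 exactly one isomorphism $e\colon(h,\beta)\to\underline{\mathrm{coNat}}(F,G)$ in $\mathcal Z(\mathcal C)$ such that for all $z=(x,\gamma)\in\mathcal Z(\mathcal C)$, $f\colon\underline{\mathrm{coNat}}(F,G)\to z$ and $m\in\mathcal M$, the morphism $f\circ e\circ i_m\colon\underline{\mathrm{coHom}}_{\mathcal N}(F(m),G(m))\to x$ corresponds to the component $\eta_m\colon G(m)\to x.F(m)$ of the module natural transformation $\eta\colon G\to z.F$ that corresponds to $f$. Thus $$\underline{\mathrm{coNat}}(F,G)\cong\int^{m\in\mathcal M}\underline{\mathrm{coHom}}_{\mathcal N}(F(m),G(m))\quad\text{canonically in }\mathcal Z(\mathcal C).$$ -/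

import Mathlib

open CategoryTheory MonoidalCategory MonoidalLeftAction Limits Opposite

universe w v₁ v₂ v₃ u₁ u₂ u₃

/-- A finite `k`-linear category: it is `k`-linearly equivalent to the category of
finite-dimensional modules over some finite-dimensional `k`-algebra `A`. (Over such an `A`, the
finite-dimensional modules are the finitely generated ones.) -/
class IsFiniteLinearCategory (k : Type w) [Field k] (D : Type u₁) [Category.{v₁} D]
    [Preadditive D] [Linear k D] : Prop where
  exists_equivalence : ∃ (A : Type w) (_ : Ring A) (_ : Algebra k A) (_ : Module.Finite k A)
    (e : D ≌ FGModuleCat.{w} A), e.functor.Additive ∧ e.functor.Linear k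

/-- A finite tensor category over `k`. It is used on top of the instances which say
that `C` is an abelian `k`-linear rigid monoidal category with `k`-bilinear tensor product. -/
class IsFiniteTensorCategory (k : Type w) [Field k] (C : Type u₁) [Category.{v₁} C]
    [Preadditive C] [Linear k C] [MonoidalCategory C] : Prop
    extends IsFiniteLinearCategory k C where
  simple_unit : Simple (𝟙_ C)

/-- A finite (left) module category over `C`: a finite `k`-linear category with an action of `C`
which is `k`-bilinear, exact in the first variable and right exact in the second one. -/
class IsFiniteModuleCategory (k : Type w) [Field k] (C : Type u₁) [Category.{v₁} C]
    [Preadditive C] [Linear k C] [MonoidalCategory C] (M : Type u₂) [Category.{v₂} M]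
    [Preadditive M] [Linear k M] [MonoidalLeftAction C M] : Prop
    extends IsFiniteLinearCategory k M where
  additive_actionRight (m : M) : (actionRight C m).Additive
  linear_actionRight (m : M) : (actionRight C m).Linear k
  additive_actionLeft (c : C) : (actionLeft M c).Additive
  linear_actionLeft (c : C) : (actionLeft M c).Linear k
  leftExact_actionRight (m : M) : PreservesFiniteLimits (actionRight C m)
  rightExact_actionRight (m : M) : PreservesFiniteColimits (actionRight C m)
  rightExact_actionLeft (c : C) : PreservesFiniteColimits (actionLeft M c)

section RexModuleFunctors

variable (k : Type w) [Field k] (C : Type u₁) [Category.{v₁} C] [MonoidalCategory C]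
  (M : Type u₂) [Category.{v₂} M] [Preadditive M] [Linear k M] [MonoidalLeftAction C M]
  (N : Type u₃) [Category.{v₃} N] [Preadditive N] [Linear k N] [MonoidalLeftAction C N]

/-- Right exact (`k`-linear) `C`-module functors from `M` to `N`. The module functor constraint
`φ_{c,m} : F (c.m) ≅ c.F m` is `Functor.OplaxLeftLinear.δₗ F c m`, with inverse
`Functor.LaxLeftLinear.μₗ F c m`. -/
structure RexModuleFunctor where
  /-- the underlying functor -/
  functor : M ⥤ N
  [additive : functor.Additive]
  [linear : functor.Linear k]
  [rightExact : PreservesFiniteColimits functor]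
  /-- the constraint `F (c.m) ≅ c.F m` of a module functor -/
  [moduleFunctor : functor.LeftLinear C]

end RexModuleFunctors

section CenterAction

open Functor.LaxLeftLinear Functor.OplaxLeftLinear Functor.LeftLinear

variable {C : Type u₁} [Category.{v₁} C] [MonoidalCategory C]
  {M : Type u₂} [Category.{v₂} M] [MonoidalLeftAction C M]
  {N : Type u₃} [Category.{v₃} N] [MonoidalLeftAction C N]

/-- For `(X, b)` in the Drinfeld center, the constraint
`X.F(c.m) ≅ X.(c.F m) ≅ (X ⊗ c).F m ≅ (c ⊗ X).F m ≅ c.(X.F m)` of the module functor `(X, b).F`. -/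
@[simps]
def actIso {X : C} (b : HalfBraiding X) (F : M ⥤ N) [F.LeftLinear C] (c : C) (m : M) :
    X ⊙ₗ F.obj (c ⊙ₗ m) ≅ c ⊙ₗ (X ⊙ₗ F.obj m) where
  hom := X ⊴ₗ δₗ F c m ≫ (αₗ X c (F.obj m)).inv ≫ (b.β c).hom ⊵ₗ F.obj m ≫
    (αₗ c X (F.obj m)).hom
  inv := (αₗ c X (F.obj m)).inv ≫ (b.β c).inv ⊵ₗ F.obj m ≫ (αₗ X c (F.obj m)).hom ≫
    X ⊴ₗ μₗ F c m
  hom_inv_id := by simp [← actionHomRight_comp]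
  inv_hom_id := by simp [← actionHomRight_comp_assoc]

lemma actIso_naturality_left {X : C} (b : HalfBraiding X) (F : M ⥤ N) [F.LeftLinear C]
    {c c' : C} (f : c ⟶ c') (m : M) :
    X ⊴ₗ F.map (f ⊵ₗ m) ≫ (actIso b F c' m).hom =
      (actIso b F c m).hom ≫ f ⊵ₗ (X ⊙ₗ F.obj m) := by
  have h1 : X ⊴ₗ f ⊵ₗ F.obj m ≫ (αₗ X c' (F.obj m)).inv =
    (αₗ X c (F.obj m)).inv ≫ (X ◁ f) ⊵ₗ F.obj m := by simp
  simp only [actIso_hom, ← actionHomRight_comp_assoc, δₗ_naturality_left]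
  simp only [actionHomRight_comp, Category.assoc]
  rw [reassoc_of% h1, ← comp_actionHomLeft_assoc, b.naturality]
  simp

lemma actIso_naturality_right {X : C} (b : HalfBraiding X) (F : M ⥤ N) [F.LeftLinear C]
    (c : C) {m m' : M} (f : m ⟶ m') :
    X ⊴ₗ F.map (c ⊴ₗ f) ≫ (actIso b F c m').hom =
      (actIso b F c m).hom ≫ c ⊴ₗ X ⊴ₗ F.map f := by
  simp only [actIso_hom, ← actionHomRight_comp_assoc, δₗ_naturality_right]
  simp only [actionHomRight_comp, Category.assoc]
  have h1 : X ⊴ₗ c ⊴ₗ F.map f ≫ (αₗ X c (F.obj m')).inv =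
    (αₗ X c (F.obj m)).inv ≫ (X ⊗ c) ⊴ₗ F.map f := by simp
  have h2 : (αₗ c X (F.obj m)).hom ≫ c ⊴ₗ X ⊴ₗ F.map f =
    (c ⊗ X) ⊴ₗ F.map f ≫ (αₗ c X (F.obj m')).hom := by simp
  rw [reassoc_of% h1, h2, action_exchange_assoc]

lemma actIso_associativity {X : C} (b : HalfBraiding X) (F : M ⥤ N) [F.LeftLinear C]
    (c c' : C) (m : M) :
    (actIso b F (c ⊗ c') m).hom ≫ (αₗ c c' (X ⊙ₗ F.obj m)).hom =
      X ⊴ₗ F.map (αₗ c c' m).hom ≫ (actIso b F c (c' ⊙ₗ m)).hom ≫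
        c ⊴ₗ (actIso b F c' m).hom := by
  have key : X ⊴ₗ δₗ F (c ⊗ c') m = X ⊴ₗ F.map (αₗ c c' m).hom ≫ X ⊴ₗ δₗ F c (c' ⊙ₗ m) ≫
      X ⊴ₗ c ⊴ₗ δₗ F c' m ≫ X ⊴ₗ (αₗ c c' (F.obj m)).inv := by
    simp [← actionHomRight_comp]
  have h1 : X ⊴ₗ c ⊴ₗ δₗ F c' m ≫ (αₗ X c _).inv =
    (αₗ X c _).inv ≫ (X ⊗ c) ⊴ₗ δₗ F c' m := by simp
  have h2 : (αₗ c X _).hom ≫ c ⊴ₗ X ⊴ₗ δₗ F c' m =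
    (c ⊗ X) ⊴ₗ δₗ F c' m ≫ (αₗ c X _).hom := by simp
  have h3 : (b.β c).hom ⊵ₗ F.obj (c' ⊙ₗ m) ≫ (c ⊗ X) ⊴ₗ δₗ F c' m =
    (X ⊗ c) ⊴ₗ δₗ F c' m ≫ (b.β c).hom ⊵ₗ (c' ⊙ₗ F.obj m) := (action_exchange _ _).symm
  have p1 := associator_actionHom X c c' (F.obj m)
  have p2 := associator_actionHom c X c' (F.obj m)
  have p3 := associator_actionHom c c' X (F.obj m)
  have q1 : X ⊴ₗ (αₗ c c' (F.obj m)).inv ≫ (αₗ X (c ⊗ c') (F.obj m)).inv ≫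
      (α_ X c c').inv ⊵ₗ F.obj m = (αₗ X c _).inv ≫ (αₗ (X ⊗ c) c' _).inv := by
    rw [← cancel_mono ((αₗ (X ⊗ c) c' (F.obj m)).hom ≫ (αₗ X c _).hom)]
    simp only [Category.assoc]
    rw [← p1, inv_hom_actionHomLeft_assoc]
    simp
  have q2 : (αₗ (c ⊗ X) c' (F.obj m)).inv ≫ (α_ c X c').hom ⊵ₗ F.obj m ≫
      (αₗ c (X ⊗ c') (F.obj m)).hom = (αₗ c X _).hom ≫ c ⊴ₗ (αₗ X c' _).inv := by
    rw [← cancel_mono (c ⊴ₗ (αₗ X c' (F.obj m)).hom)]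
    simp only [Category.assoc, p2]
    simp
  have q3 : (αₗ c (c' ⊗ X) (F.obj m)).inv ≫ (α_ c c' X).inv ⊵ₗ F.obj m ≫
      (αₗ (c ⊗ c') X (F.obj m)).hom ≫ (αₗ c c' _).hom = c ⊴ₗ (αₗ c' X _).hom := by
    rw [← p3, inv_hom_actionHomLeft_assoc]
    simp
  simp only [actIso_hom, key, Category.assoc, b.monoidal, comp_actionHomLeft,
    actionHomRight_comp]
  rw [reassoc_of% h2, reassoc_of% h3, ← reassoc_of% h1]
  simp only [whiskerRight_actionHomLeft, whiskerLeft_actionHomLeft, Category.assoc]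
  rw [reassoc_of% q1, q3, reassoc_of% q2]
  simp

lemma halfBraiding_unit {X : C} (b : HalfBraiding X) :
    (b.β (𝟙_ C)).hom = (ρ_ X).hom ≫ (λ_ X).inv := by
  have h := b.naturality (λ_ (𝟙_ C)).hom
  rw [b.monoidal] at h
  have h1 : 𝟙_ C ◁ (b.β (𝟙_ C)).hom ≫ (α_ (𝟙_ C) (𝟙_ C) X).inv ≫ (λ_ (𝟙_ C)).hom ▷ X =
      (λ_ (X ⊗ 𝟙_ C)).hom ≫ (b.β (𝟙_ C)).hom := by
    rw [← leftUnitor_naturality]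
    simp
  simp only [Category.assoc] at h
  rw [h1] at h
  simp only [← Category.assoc] at h
  rw [cancel_mono] at h
  rw [Iso.eq_comp_inv]
  have h2 : ((b.β (𝟙_ C)).hom ≫ (λ_ X).hom) ▷ 𝟙_ C = (ρ_ X).hom ▷ 𝟙_ C := by
    rw [← triangle, h]
    simp only [comp_whiskerRight]
    monoidal
  rwa [whiskerRight_id, whiskerRight_id, cancel_epi, cancel_mono] at h2

lemma actIso_unitality {X : C} (b : HalfBraiding X) (F : M ⥤ N) [F.LeftLinear C] (m : M) :
    (λₗ[C] (X ⊙ₗ F.obj m)).inv = X ⊴ₗ F.map (λₗ[C] m).inv ≫ (actIso b F (𝟙_ C) m).hom := by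
  rw [actIso_hom, ← actionHomRight_comp_assoc, ← δₗ_unitality_inv, halfBraiding_unit, comp_actionHomLeft,
    rightUnitor_actionHom]
  have h : (λ_ X).inv ⊵ₗ F.obj m = (λₗ[C] _).inv ≫ (αₗ (𝟙_ C) X (F.obj m)).inv := by
    rw [← cancel_mono ((λ_ X).hom ⊵ₗ F.obj m), inv_hom_actionHomLeft, leftUnitor_actionHom]
    simp
  simp only [h, Category.assoc, Iso.inv_hom_id, Iso.inv_hom_id_assoc, Category.comp_id]
  rw [← actionHomRight_comp_assoc, Iso.inv_hom_id, actionHomRight_id, Category.id_comp]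

lemma actIso_inv_naturality_left {X : C} (b : HalfBraiding X) (F : M ⥤ N) [F.LeftLinear C]
    {c c' : C} (f : c ⟶ c') (m : M) :
    f ⊵ₗ (X ⊙ₗ F.obj m) ≫ (actIso b F c' m).inv =
      (actIso b F c m).inv ≫ X ⊴ₗ F.map (f ⊵ₗ m) := by
  rw [Iso.comp_inv_eq, Category.assoc, Iso.eq_inv_comp, actIso_naturality_left]

lemma actIso_inv_naturality_right {X : C} (b : HalfBraiding X) (F : M ⥤ N) [F.LeftLinear C]
    (c : C) {m m' : M} (f : m ⟶ m') :
    c ⊴ₗ X ⊴ₗ F.map f ≫ (actIso b F c m').inv =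
      (actIso b F c m).inv ≫ X ⊴ₗ F.map (c ⊴ₗ f) := by
  rw [Iso.comp_inv_eq, Category.assoc, Iso.eq_inv_comp, actIso_naturality_right]

lemma actIso_inv_associativity {X : C} (b : HalfBraiding X) (F : M ⥤ N) [F.LeftLinear C]
    (c c' : C) (m : M) :
    (actIso b F (c ⊗ c') m).inv ≫ X ⊴ₗ F.map (αₗ c c' m).hom =
      (αₗ c c' (X ⊙ₗ F.obj m)).hom ≫ c ⊴ₗ (actIso b F c' m).inv ≫
        (actIso b F c (c' ⊙ₗ m)).inv := by
  rw [Iso.inv_comp_eq, reassoc_of% (actIso_associativity b F c c' m),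
    actionHomRight_hom_inv_assoc, Iso.hom_inv_id, Category.comp_id]

lemma actIso_inv_unitality {X : C} (b : HalfBraiding X) (F : M ⥤ N) [F.LeftLinear C] (m : M) :
    (λₗ[C] (X ⊙ₗ F.obj m)).hom = (actIso b F (𝟙_ C) m).inv ≫ X ⊴ₗ F.map (λₗ[C] m).hom := by
  rw [Iso.eq_inv_comp, ← Iso.eq_comp_inv, actIso_unitality, ← actionHomRight_comp_assoc,
    ← F.map_comp, Iso.hom_inv_id, F.map_id, actionHomRight_id, Category.id_comp]

/-- The module functor structure on `X.F` for `(X, b)` in the Drinfeld center. -/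
@[reducible]
def actLeftLinear {X : C} (b : HalfBraiding X) (F : M ⥤ N) [F.LeftLinear C] :
    (F ⋙ actionLeft N X).LeftLinear C where
  μₗ c m := (actIso b F c m).inv
  δₗ c m := (actIso b F c m).hom
  μₗ_naturality_left f m := actIso_inv_naturality_left b F f m
  μₗ_naturality_right c _ _ f := actIso_inv_naturality_right b F c f
  μₗ_associativity c c' m := actIso_inv_associativity b F c c' m
  μₗ_unitality m := actIso_inv_unitality b F m
  δₗ_naturality_left f m := actIso_naturality_left b F f m
  δₗ_naturality_right c _ _ f := actIso_naturality_right b F c f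
  δₗ_associativity c c' m := actIso_associativity b F c c' m
  δₗ_unitality_inv m := actIso_unitality b F m
  μₗ_comp_δₗ c m := (actIso b F c m).inv_hom_id
  δₗ_comp_μₗ c m := (actIso b F c m).hom_inv_id

lemma act_comm_left {X Y : C} (b : HalfBraiding X) (b' : HalfBraiding Y) (F : M ⥤ N)
    [F.LeftLinear C] (f : X ⟶ Y)
    (hf : ∀ U, f ▷ U ≫ (b'.β U).hom = (b.β U).hom ≫ U ◁ f) (c : C) (m : M) :
    f ⊵ₗ F.obj (c ⊙ₗ m) ≫ (actIso b' F c m).hom =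
      (actIso b F c m).hom ≫ c ⊴ₗ f ⊵ₗ F.obj m := by
  have h1 : f ⊵ₗ (c ⊙ₗ F.obj m) ≫ (αₗ Y c (F.obj m)).inv =
    (αₗ X c (F.obj m)).inv ≫ (f ▷ c) ⊵ₗ F.obj m := by simp
  rw [actIso_hom, ← action_exchange_assoc, reassoc_of% h1, ← comp_actionHomLeft_assoc, hf]
  simp

lemma act_comm_right {X : C} (b : HalfBraiding X) {F G : M ⥤ N} [F.LeftLinear C]
    [G.LeftLinear C] (η : F ⟶ G)
    (hη : ∀ (c : C) (m : M), η.app (c ⊙ₗ m) ≫ δₗ G c m = δₗ F c m ≫ c ⊴ₗ η.app m)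
    (c : C) (m : M) :
    X ⊴ₗ η.app (c ⊙ₗ m) ≫ (actIso b G c m).hom =
      (actIso b F c m).hom ≫ c ⊴ₗ X ⊴ₗ η.app m := by
  have h1 : X ⊴ₗ c ⊴ₗ η.app m ≫ (αₗ X c (G.obj m)).inv =
    (αₗ X c (F.obj m)).inv ≫ (X ⊗ c) ⊴ₗ η.app m := by simp
  have h2 : (αₗ c X (F.obj m)).hom ≫ c ⊴ₗ X ⊴ₗ η.app m =
    (c ⊗ X) ⊴ₗ η.app m ≫ (αₗ c X (G.obj m)).hom := by simp
  simp only [actIso_hom, ← actionHomRight_comp_assoc, hη]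
  simp only [actionHomRight_comp, Category.assoc]
  rw [reassoc_of% h1, h2, action_exchange_assoc]

lemma act_comm_assoc {X Y : C} (b : HalfBraiding X) (b' : HalfBraiding Y)
    (b'' : HalfBraiding (X ⊗ Y)) (F : M ⥤ N) [F.LeftLinear C] (c : C) (m : M)
    (h : (b''.β c).hom = (α_ X Y c).hom ≫ X ◁ (b'.β c).hom ≫ (α_ X c Y).inv ≫
      (b.β c).hom ▷ Y ≫ (α_ c X Y).hom) :
    (αₗ X Y (F.obj (c ⊙ₗ m))).hom ≫ X ⊴ₗ (actIso b' F c m).hom ≫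
      (αₗ X c (Y ⊙ₗ F.obj m)).inv ≫ (b.β c).hom ⊵ₗ (Y ⊙ₗ F.obj m) ≫
        (αₗ c X (Y ⊙ₗ F.obj m)).hom =
      (actIso b'' F c m).hom ≫ c ⊴ₗ (αₗ X Y (F.obj m)).hom := by
  have h1 : (αₗ X Y (F.obj (c ⊙ₗ m))).hom ≫ X ⊴ₗ Y ⊴ₗ δₗ F c m =
    (X ⊗ Y) ⊴ₗ δₗ F c m ≫ (αₗ X Y _).hom := by simp
  have p1 := associator_actionHom X Y c (F.obj m)
  have p2 := associator_actionHom X c Y (F.obj m)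
  have p3 := associator_actionHom c X Y (F.obj m)
  have q1 : (αₗ X Y (c ⊙ₗ F.obj m)).hom ≫ X ⊴ₗ (αₗ Y c (F.obj m)).inv =
      (αₗ (X ⊗ Y) c (F.obj m)).inv ≫ (α_ X Y c).hom ⊵ₗ F.obj m ≫
        (αₗ X (Y ⊗ c) (F.obj m)).hom := by
    rw [← cancel_mono (X ⊴ₗ (αₗ Y c (F.obj m)).hom)]
    simp only [Category.assoc, p1]
    simp
  have q2 : X ⊴ₗ (αₗ c Y (F.obj m)).hom ≫ (αₗ X c (Y ⊙ₗ F.obj m)).inv =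
      (αₗ X (c ⊗ Y) (F.obj m)).inv ≫ (α_ X c Y).inv ⊵ₗ F.obj m ≫
        (αₗ (X ⊗ c) Y (F.obj m)).hom := by
    rw [Iso.comp_inv_eq]
    simp only [Category.assoc]
    rw [← p2, inv_hom_actionHomLeft_assoc, Iso.inv_hom_id_assoc]
  simp only [actIso_hom, actionHomRight_comp, Category.assoc]
  rw [reassoc_of% h1, reassoc_of% q1, reassoc_of% q2, h]
  simp only [comp_actionHomLeft, Category.assoc, p3]
  simp only [whiskerLeft_actionHomLeft, whiskerRight_actionHomLeft, Category.assoc,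
    Iso.inv_hom_id_assoc]

lemma act_comm_unit (b : HalfBraiding (𝟙_ C)) (F : M ⥤ N) [F.LeftLinear C] (c : C) (m : M)
    (h : (b.β c).hom = (λ_ c).hom ≫ (ρ_ c).inv) :
    (λₗ[C] (F.obj (c ⊙ₗ m))).hom ≫ δₗ F c m =
      (actIso b F c m).hom ≫ c ⊴ₗ (λₗ[C] (F.obj m)).hom := by
  have h1 : (ρ_ c).inv ⊵ₗ F.obj m = c ⊴ₗ (λₗ[C] _).inv ≫ (αₗ c (𝟙_ C) (F.obj m)).inv := by
    rw [← cancel_mono ((ρ_ c).hom ⊵ₗ F.obj m), inv_hom_actionHomLeft, rightUnitor_actionHom]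
    simp [← actionHomRight_comp]
  rw [actionUnitIso_hom_naturality, actIso_hom, h]
  simp only [comp_actionHomLeft, leftUnitor_actionHom, h1, Category.assoc,
    Iso.inv_hom_id_assoc, actionHomRight_inv_hom, Category.comp_id]

lemma actAssoc_naturality (X Y : C) {n n' : N} (f : n ⟶ n') :
    (X ⊗ Y) ⊴ₗ f ≫ (αₗ X Y n').hom = (αₗ X Y n).hom ≫ X ⊴ₗ Y ⊴ₗ f := by
  simp

lemma actHom_comp {X Y Z : C} (f : X ⟶ Y) (g : Y ⟶ Z) {n n' n'' : N} (h : n ⟶ n')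
    (h' : n' ⟶ n'') : (f ≫ g) ⊵ₗ n ≫ Z ⊴ₗ (h ≫ h') =
      (f ⊵ₗ n ≫ Y ⊴ₗ h) ≫ (g ⊵ₗ n' ≫ Z ⊴ₗ h') := by
  simp only [← actionHom_def, actionHom_comp]

lemma actAssoc_naturality' {X X' Y Y' : C} (f : X ⟶ X') (g : Y ⟶ Y') {n n' : N} (h : n ⟶ n') :
    ((f ⊗ₘ g) ⊵ₗ n ≫ (X' ⊗ Y') ⊴ₗ h) ≫ (αₗ X' Y' n').hom =
      (αₗ X Y n).hom ≫ f ⊵ₗ (Y ⊙ₗ n) ≫ X' ⊴ₗ (g ⊵ₗ n ≫ Y' ⊴ₗ h) := by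
  simp only [← actionHom_def, actionAssocIso_hom_naturality]

end CenterAction

namespace RexModuleFunctor

attribute [instance] additive linear rightExact moduleFunctor

open Functor.LaxLeftLinear Functor.OplaxLeftLinear Functor.LeftLinear

variable {k : Type w} [Field k] {C : Type u₁} [Category.{v₁} C] [MonoidalCategory C]
  {M : Type u₂} [Category.{v₂} M] [Preadditive M] [Linear k M] [MonoidalLeftAction C M]
  {N : Type u₃} [Category.{v₃} N] [Preadditive N] [Linear k N] [MonoidalLeftAction C N]

/-- Module natural transformations. -/
@[ext]
structure Hom (F G : RexModuleFunctor k C M N) where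
  /-- the underlying natural transformation -/
  nat : F.functor ⟶ G.functor
  comm (c : C) (m : M) : nat.app (c ⊙ₗ m) ≫ δₗ G.functor c m =
    δₗ F.functor c m ≫ c ⊴ₗ nat.app m

/-- The category `Rex_C(M,N)`. -/
instance : Category (RexModuleFunctor k C M N) where
  Hom F G := Hom F G
  id F := { nat := 𝟙 _, comm := by simp }
  comp f g := { nat := f.nat ≫ g.nat
                comm := fun c m => by
                  simp only [NatTrans.comp_app, Category.assoc, g.comm, actionHomRight_comp]
                  rw [← Category.assoc, f.comm, Category.assoc] }

@[ext]
lemma hom_ext {F G : RexModuleFunctor k C M N} {f g : F ⟶ G}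
    (h : ∀ m, f.nat.app m = g.nat.app m) : f = g :=
  Hom.ext (NatTrans.ext (funext h))

@[simp] lemma id_nat (F : RexModuleFunctor k C M N) : Hom.nat (𝟙 F) = 𝟙 F.functor := rfl

@[simp] lemma comp_nat {F G H : RexModuleFunctor k C M N} (f : F ⟶ G) (g : G ⟶ H) :
    Hom.nat (f ≫ g) = f.nat ≫ g.nat := rfl

/-- An isomorphism from a module natural isomorphism. -/
@[simps]
def isoMk {F G : RexModuleFunctor k C M N} (e : F.functor ≅ G.functor)
    (he : ∀ (c : C) (m : M), e.hom.app (c ⊙ₗ m) ≫ δₗ G.functor c m =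
      δₗ F.functor c m ≫ c ⊴ₗ e.hom.app m) : F ≅ G where
  hom := ⟨e.hom, he⟩
  inv := ⟨e.inv, fun c m => by
    rw [← cancel_epi (e.hom.app (c ⊙ₗ m)), ← Category.assoc, ← Category.assoc, he]
    simp [← actionHomRight_comp]⟩
  hom_inv_id := by ext m; simp
  inv_hom_id := by ext m; simp

/-- The module functor `z.F`, sending `m` to `z.F(m)`. -/
def act [Preadditive C] [Linear k C] [IsFiniteModuleCategory k C N] (z : Center C)
    (F : RexModuleFunctor k C M N) : RexModuleFunctor k C M N :=
  haveI : (actionLeft N z.1).Additive := IsFiniteModuleCategory.additive_actionLeft k z.1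
  haveI : (actionLeft N z.1).Linear k := IsFiniteModuleCategory.linear_actionLeft z.1
  haveI : PreservesFiniteColimits (actionLeft N z.1) :=
    IsFiniteModuleCategory.rightExact_actionLeft k z.1
  { functor := F.functor ⋙ actionLeft N z.1
    rightExact := comp_preservesFiniteColimits _ _
    moduleFunctor := actLeftLinear z.2 F.functor }

variable [Preadditive C] [Linear k C] [IsFiniteModuleCategory k C N]

/-- `f.F : z.F ⟶ z'.F` for `f : z ⟶ z'` -/
def actLeft {z z' : Center C} (f : z ⟶ z') (F : RexModuleFunctor k C M N) :
    act z F ⟶ act z' F where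
  nat :=
    { app := fun m => f.f ⊵ₗ F.functor.obj m
      naturality := fun _ _ g => action_exchange f.f (F.functor.map g) }
  comm c m := act_comm_left z.2 z'.2 F.functor f.f f.comm c m

/-- `z.η : z.F ⟶ z.G` for `η : F ⟶ G` -/
def actRight (z : Center C) {F G : RexModuleFunctor k C M N} (η : F ⟶ G) :
    act z F ⟶ act z G where
  nat := Functor.whiskerRight η.nat (actionLeft N z.1)
  comm c m := act_comm_right z.2 η.nat η.comm c m

/-- `(z ⊗ z').F ≅ z.(z'.F)` -/
noncomputable def actAssoc (z z' : Center C) (F : RexModuleFunctor k C M N) :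
    act (z ⊗ z') F ≅ act z (act z' F) :=
  isoMk (NatIso.ofComponents (fun m => αₗ z.1 z'.1 (F.functor.obj m))
    (fun f => actAssoc_naturality z.1 z'.1 (F.functor.map f)))
    (fun c m => act_comm_assoc z.2 z'.2 (z ⊗ z').2 F.functor c m rfl)

/-- `1.F ≅ F` -/
noncomputable def actUnit (F : RexModuleFunctor k C M N) : act (𝟙_ (Center C)) F ≅ F :=
  isoMk (NatIso.ofComponents (fun m => λₗ[C] (F.functor.obj m))
    (fun f => (actionUnitIso_hom_naturality (F.functor.map f)).symm))
    (fun c m => act_comm_unit (𝟙_ (Center C)).2 F.functor c m rfl)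

/-- The category `Rex_C(M,N)` as a module category over the Drinfeld center of `C`. -/
noncomputable instance : MonoidalLeftAction (Center C) (RexModuleFunctor k C M N) where
  actionObj := act
  actionHomLeft := actLeft
  actionHomRight := actRight
  actionAssocIso := actAssoc
  actionUnitIso := actUnit
  actionHom_def _ _ := rfl
  actionHomRight_id z F := by
    ext m
    exact actionHomRight_id z.1 (F.functor.obj m)
  id_actionHomLeft z F := by
    ext m
    exact id_actionHomLeft z.1 (F.functor.obj m)
  actionHom_comp {_ _ _ F _ _} f g a b := by
    ext m
    exact actHom_comp f.f g.f (a.nat.app m) (b.nat.app m)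
  actionAssocIso_hom_naturality f g a := by
    ext m
    exact actAssoc_naturality' f.f g.f (a.nat.app m)
  actionUnitIso_hom_naturality a := by
    ext m
    exact actionUnitIso_hom_naturality (a.nat.app m)
  whiskerLeft_actionHomLeft z _ _ f F := by
    ext m
    exact whiskerLeft_actionHomLeft z.1 f.f (F.functor.obj m)
  whiskerRight_actionHomLeft z f F := by
    ext m
    exact whiskerRight_actionHomLeft z.1 f.f (F.functor.obj m)
  associator_actionHom z z' z'' F := by
    ext m
    exact associator_actionHom z.1 z'.1 z''.1 (F.functor.obj m)
  leftUnitor_actionHom z F := by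
    ext m
    exact leftUnitor_actionHom z.1 (F.functor.obj m)
  rightUnitor_actionHom z F := by
    ext m
    exact rightUnitor_actionHom z.1 (F.functor.obj m)

end RexModuleFunctor

section YonedaIso

variable {C : Type u₁} [Category.{v₁} C]

/-- The isomorphism `X ≅ Y` given by a natural bijection `Hom(γ, X) ≃ Hom(γ, Y)`. -/
@[simps]
def isoOfHomToEquiv {X Y : C} (e : ∀ γ, (γ ⟶ X) ≃ (γ ⟶ Y))
    (he : ∀ {γ γ' : C} (f : γ ⟶ γ') (g : γ' ⟶ X), e γ (f ≫ g) = f ≫ e γ' g) : X ≅ Y where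
  hom := e X (𝟙 X)
  inv := (e Y).symm (𝟙 Y)
  hom_inv_id := by
    apply (e X).injective
    rw [he]
    simp
  inv_hom_id := by
    rw [← he]
    simp

/-- The isomorphism `Y ≅ X` given by a natural bijection `Hom(X, γ) ≃ Hom(Y, γ)`. -/
@[simps]
def isoOfHomFromEquiv {X Y : C} (e : ∀ γ, (X ⟶ γ) ≃ (Y ⟶ γ))
    (he : ∀ {γ γ' : C} (g : X ⟶ γ) (f : γ ⟶ γ'), e γ' (g ≫ f) = e γ g ≫ f) : Y ≅ X where
  hom := e X (𝟙 X)
  inv := (e Y).symm (𝟙 Y)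
  hom_inv_id := by
    rw [← he]
    simp
  inv_hom_id := by
    apply (e X).injective
    rw [he]
    simp

end YonedaIso

section Duality

variable {C : Type u₁} [Category.{v₁} C] [MonoidalCategory C]
  {M : Type u₂} [Category.{v₂} M] [MonoidalLeftAction C M]

/-- If `Y` is right dual to `X`, then acting with `Y` is left adjoint to acting with `X`. -/
def actionHomEquiv (X Y : C) [ExactPairing X Y] (m m' : M) :
    (Y ⊙ₗ m ⟶ m') ≃ (m ⟶ X ⊙ₗ m') where
  toFun f := (λₗ[C] m).inv ≫ η_ X Y ⊵ₗ m ≫ (αₗ X Y m).hom ≫ X ⊴ₗ f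
  invFun f := Y ⊴ₗ f ≫ (αₗ Y X m').inv ≫ ε_ X Y ⊵ₗ m' ≫ (λₗ[C] m').hom
  left_inv f := by
    have z := congrArg (fun t => t ⊵ₗ m) (ExactPairing.coevaluation_evaluation X Y)
    simp only [comp_actionHomLeft, whiskerLeft_actionHomLeft, whiskerRight_actionHomLeft,
      rightUnitor_actionHom, Category.assoc] at z
    have h1 : Y ⊴ₗ X ⊴ₗ f ≫ (αₗ Y X m').inv = (αₗ Y X _).inv ≫ (Y ⊗ X) ⊴ₗ f := by simp
    simp only [actionHomRight_comp, Category.assoc]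
    rw [reassoc_of% h1, action_exchange_assoc, ← actionUnitIso_hom_naturality]
    have p := associator_actionHom Y X Y m
    have q : (αₗ Y (X ⊗ Y) m).inv ≫ (α_ Y X Y).inv ⊵ₗ m ≫ (αₗ (Y ⊗ X) Y m).hom =
        Y ⊴ₗ (αₗ X Y m).hom ≫ (αₗ Y X (Y ⊙ₗ m)).inv := by
      rw [Iso.eq_comp_inv]
      simp only [Category.assoc]
      rw [← p, inv_hom_actionHomLeft_assoc, Iso.inv_hom_id_assoc]
    have l : (λ_ Y).inv ⊵ₗ m = (λₗ[C] (Y ⊙ₗ m)).inv ≫ (αₗ (𝟙_ C) Y m).inv := by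
      rw [← cancel_mono ((λ_ Y).hom ⊵ₗ m), inv_hom_actionHomLeft, leftUnitor_actionHom]
      simp
    rw [cancel_epi, reassoc_of% q, l] at z
    simp only [← Category.assoc, cancel_mono] at z
    simp only [Category.assoc] at z
    rw [reassoc_of% z, Iso.inv_hom_id_assoc, actionHomRight_inv_hom_assoc]
  right_inv f := by
    have z := congrArg (fun t => t ⊵ₗ m') (ExactPairing.evaluation_coevaluation X Y)
    simp only [comp_actionHomLeft, whiskerLeft_actionHomLeft, whiskerRight_actionHomLeft,
      leftUnitor_actionHom, Category.assoc] at z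
    have h1 : (αₗ X Y m).hom ≫ X ⊴ₗ Y ⊴ₗ f = (X ⊗ Y) ⊴ₗ f ≫ (αₗ X Y _).hom := by simp
    simp only [actionHomRight_comp]
    rw [reassoc_of% h1, ← action_exchange_assoc]
    have p := associator_actionHom X Y X m'
    have q : (αₗ (X ⊗ Y) X m').inv ≫ (α_ X Y X).hom ⊵ₗ m' ≫ (αₗ X (Y ⊗ X) m').hom =
        (αₗ X Y (X ⊙ₗ m')).hom ≫ X ⊴ₗ (αₗ Y X m').inv := by
      rw [← cancel_mono (X ⊴ₗ (αₗ Y X m').hom)]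
      simp only [Category.assoc, p]
      simp
    have l : (ρ_ X).inv ⊵ₗ m' = X ⊴ₗ (λₗ[C] m').inv ≫ (αₗ X (𝟙_ C) m').inv := by
      rw [← cancel_mono ((ρ_ X).hom ⊵ₗ m'), inv_hom_actionHomLeft, rightUnitor_actionHom]
      simp [← actionHomRight_comp]
    rw [cancel_epi, reassoc_of% q, l] at z
    simp only [← Category.assoc, cancel_mono] at z
    simp only [Category.assoc] at z
    rw [reassoc_of% z, actionHomRight_inv_hom, Category.comp_id, ← actionUnitIso_hom_naturality,
      Iso.inv_hom_id_assoc]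

end Duality

/-- An internal Hom of a `C`-module category `M`: a functor `Mᵒᵖ × M ⥤ C` with bijections
`Hom_C(c, hom(m, m')) ≃ Hom_M(c.m, m')`, natural in all three variables. -/
structure InternalHom (C : Type u₁) [Category.{v₁} C] [MonoidalCategory C]
    (M : Type u₂) [Category.{v₂} M] [MonoidalLeftAction C M] where
  /-- the internal Hom functor -/
  hom : Mᵒᵖ ⥤ M ⥤ C
  /-- the adjunctions `(-).m ⊣ hom(m, -)`, natural in `m` -/
  adj : (curriedAction C M).flip ⊣₂ hom

/-- An internal coHom of a `C`-module category `M`: a functor `Mᵒᵖ × M ⥤ C` with bijections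
`Hom_C(cohom(m', m), c) ≃ Hom_M(m, c.m')`, natural in all three variables. -/
structure InternalCohom (C : Type u₁) [Category.{v₁} C] [MonoidalCategory C]
    (M : Type u₂) [Category.{v₂} M] [MonoidalLeftAction C M] where
  /-- the internal coHom functor -/
  cohom : Mᵒᵖ ⥤ M ⥤ C
  /-- the adjunctions `cohom(m', -) ⊣ (-).m'`, natural in `m'` -/
  adj : cohom ⊣₂ (unopUnop M ⋙ (curriedAction C M).flip)

namespace InternalHom

variable {C : Type u₁} [Category.{v₁} C] [MonoidalCategory C]
  {M : Type u₂} [Category.{v₂} M] [MonoidalLeftAction C M] (H : InternalHom C M)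

/-- The internal Hom object. -/
abbrev ihom (m m' : M) : C := (H.hom.obj (op m)).obj m'

/-- The bijection `Hom_M(c.m, m') ≃ Hom_C(c, ihom(m, m'))`. -/
def homEquiv (c : C) (m m' : M) : (c ⊙ₗ m ⟶ m') ≃ (c ⟶ H.ihom m m') :=
  H.adj.homEquiv (X₁ := m) (X₂ := c) (X₃ := m')

lemma homEquiv_naturality {c c' : C} {m m' : M} (f : c ⟶ c') (g : c' ⊙ₗ m ⟶ m') :
    H.homEquiv c m m' (f ⊵ₗ m ≫ g) = f ≫ H.homEquiv c' m m' g :=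
  H.adj.homEquiv_naturality_two f g

lemma homEquiv_symm_naturality {c c' : C} {m m' : M} (f : c ⟶ c') (g : c' ⟶ H.ihom m m') :
    (H.homEquiv c m m').symm (f ≫ g) = f ⊵ₗ m ≫ (H.homEquiv c' m m').symm g :=
  H.adj.homEquiv_symm_naturality_two f g

variable [RigidCategory C]

/-- The isomorphism `ihom(m, c.m') ≅ c ⊗ ihom(m, m')`, defined through
`Hom(γ, ihom(m, c.m')) ≅ Hom(γ.m, c.m') ≅ Hom(cᘁ.(γ.m), m') ≅ Hom((cᘁ ⊗ γ).m, m')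
≅ Hom(cᘁ ⊗ γ, ihom(m, m')) ≅ Hom(γ, c ⊗ ihom(m, m'))`. -/
def leftModuleIso (c : C) (m m' : M) : H.ihom m (c ⊙ₗ m') ≅ c ⊗ H.ihom m m' :=
  isoOfHomToEquiv
    (fun γ => (H.homEquiv γ m (c ⊙ₗ m')).symm.trans <|
      (actionHomEquiv c cᘁ (γ ⊙ₗ m) m').symm.trans <|
      (Iso.homCongr (αₗ cᘁ γ m).symm (Iso.refl m')).trans <|
      (H.homEquiv (cᘁ ⊗ γ) m m').trans <|
      tensorLeftHomEquiv γ c cᘁ (H.ihom m m'))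
    (fun {γ γ'} f g => by
      apply (tensorLeftHomEquiv γ c cᘁ (H.ihom m m')).symm.injective
      rw [tensorLeftHomEquiv_symm_naturality]
      simp [homEquiv_symm_naturality, ← homEquiv_naturality, actionHomEquiv])

/-- The isomorphism `ihom(c.m, m') ≅ ihom(m, m') ⊗ cᘁ`, defined through
`Hom(γ, ihom(c.m, m')) ≅ Hom(γ.(c.m), m') ≅ Hom((γ ⊗ c).m, m') ≅ Hom(γ ⊗ c, ihom(m, m'))
≅ Hom(γ, ihom(m, m') ⊗ cᘁ)`. -/
def rightModuleIso (c : C) (m m' : M) : H.ihom (c ⊙ₗ m) m' ≅ H.ihom m m' ⊗ cᘁ :=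
  isoOfHomToEquiv
    (fun γ => (H.homEquiv γ (c ⊙ₗ m) m').symm.trans <|
      (Iso.homCongr (αₗ γ c m).symm (Iso.refl m')).trans <|
      (H.homEquiv (γ ⊗ c) m m').trans <|
      tensorRightHomEquiv γ c cᘁ (H.ihom m m'))
    (fun {γ γ'} f g => by
      apply (tensorRightHomEquiv γ c cᘁ (H.ihom m m')).symm.injective
      rw [tensorRightHomEquiv_symm_naturality]
      simp [homEquiv_symm_naturality, ← homEquiv_naturality])

/-- The bimodule functor structure `ihom(c.m, c'.m') ≅ c' ⊗ ihom(m, m') ⊗ cᘁ` of the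
internal Hom. -/
def bimoduleIso (c c' : C) (m m' : M) :
    H.ihom (c ⊙ₗ m) (c' ⊙ₗ m') ≅ (c' ⊗ H.ihom m m') ⊗ cᘁ :=
  H.rightModuleIso c m (c' ⊙ₗ m') ≪≫ whiskerRightIso (H.leftModuleIso c' m m') cᘁ

end InternalHom

namespace InternalCohom

variable {C : Type u₁} [Category.{v₁} C] [MonoidalCategory C]
  {M : Type u₂} [Category.{v₂} M] [MonoidalLeftAction C M] (H : InternalCohom C M)

/-- The internal coHom object. -/
abbrev icohom (m' m : M) : C := (H.cohom.obj (op m')).obj m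

/-- The bijection `Hom_C(icohom(m', m), c) ≃ Hom_M(m, c.m')`. -/
def homEquiv (m' m : M) (c : C) : (H.icohom m' m ⟶ c) ≃ (m ⟶ c ⊙ₗ m') :=
  H.adj.homEquiv (X₁ := op m') (X₂ := m) (X₃ := c)

lemma homEquiv_naturality {c c' : C} {m m' : M} (g : H.icohom m' m ⟶ c) (f : c ⟶ c') :
    H.homEquiv m' m c' (g ≫ f) = H.homEquiv m' m c g ≫ f ⊵ₗ m' :=
  H.adj.homEquiv_naturality_three f g

lemma homEquiv_symm_naturality {c c' : C} {m m' : M} (g : m ⟶ c ⊙ₗ m') (f : c ⟶ c') :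
    (H.homEquiv m' m c').symm (g ≫ f ⊵ₗ m') = (H.homEquiv m' m c).symm g ≫ f :=
  H.adj.homEquiv_symm_naturality_three f g

variable [RigidCategory C]

/-- The isomorphism `c ⊗ icohom(m', m) ≅ icohom(m', c.m)`, defined through
`Hom(icohom(m', c.m), γ) ≅ Hom(c.m, γ.m') ≅ Hom(m, ᘁc.(γ.m')) ≅ Hom(m, (ᘁc ⊗ γ).m')
≅ Hom(icohom(m', m), ᘁc ⊗ γ) ≅ Hom(c ⊗ icohom(m', m), γ)`. -/
def leftModuleIso (c : C) (m' m : M) : c ⊗ H.icohom m' m ≅ H.icohom m' (c ⊙ₗ m) :=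
  isoOfHomFromEquiv
    (fun γ => (H.homEquiv m' (c ⊙ₗ m) γ).trans <|
      (actionHomEquiv (ᘁc : C) c m (γ ⊙ₗ m')).trans <|
      (Iso.homCongr (Iso.refl m) (αₗ (ᘁc : C) γ m').symm).trans <|
      (H.homEquiv m' m ((ᘁc : C) ⊗ γ)).symm.trans <|
      (tensorLeftHomEquiv (H.icohom m' m) (ᘁc : C) c γ).symm)
    (fun {γ γ'} g f => by
      apply (tensorLeftHomEquiv (H.icohom m' m) (ᘁc : C) c γ').injective
      rw [tensorLeftHomEquiv_naturality]
      simp [homEquiv_naturality, ← homEquiv_symm_naturality, actionHomEquiv])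

/-- The isomorphism `icohom(m', m) ⊗ ᘁc ≅ icohom(c.m', m)`, defined through
`Hom(icohom(c.m', m), γ) ≅ Hom(m, γ.(c.m')) ≅ Hom(m, (γ ⊗ c).m') ≅ Hom(icohom(m', m), γ ⊗ c)
≅ Hom(icohom(m', m) ⊗ ᘁc, γ)`. -/
def rightModuleIso (c : C) (m' m : M) : H.icohom m' m ⊗ (ᘁc : C) ≅ H.icohom (c ⊙ₗ m') m :=
  isoOfHomFromEquiv
    (fun γ => (H.homEquiv (c ⊙ₗ m') m γ).trans <|
      (Iso.homCongr (Iso.refl m) (αₗ γ c m').symm).trans <|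
      (H.homEquiv m' m (γ ⊗ c)).symm.trans <|
      (tensorRightHomEquiv (H.icohom m' m) (ᘁc : C) c γ).symm)
    (fun {γ γ'} g f => by
      apply (tensorRightHomEquiv (H.icohom m' m) (ᘁc : C) c γ').injective
      rw [tensorRightHomEquiv_naturality]
      simp [homEquiv_naturality, ← homEquiv_symm_naturality])

/-- The bimodule functor structure `c' ⊗ icohom(m', m) ⊗ ᘁc ≅ icohom(c.m', c'.m)` of the
internal coHom. -/
def bimoduleIso (c c' : C) (m' m : M) :
    (c' ⊗ H.icohom m' m) ⊗ (ᘁc : C) ≅ H.icohom (c ⊙ₗ m') (c' ⊙ₗ m) :=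
  whiskerRightIso (H.leftModuleIso c' m' m) (ᘁc : C) ≪≫ H.rightModuleIso c m' (c' ⊙ₗ m)

end InternalCohom

/-- The object of the Drinfeld center given by an object and a half-braiding on it. -/
def centerMk {C : Type u₁} [Category.{v₁} C] [MonoidalCategory C] (X : C) (b : HalfBraiding X) :
    Center C := ⟨X, b⟩

section CentralIntegration

variable {C : Type u₁} [Category.{v₁} C] [MonoidalCategory C] [RigidCategory C]
  {M : Type u₂} [Category.{v₂} M] [MonoidalLeftAction C M]

/-- The component `g ⟶ c ⊗ g ⊗ cᘁ` at `c` of the coaction of the central comonad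
`∫_c c ⊗ - ⊗ cᘁ` on `g` which corresponds to a half-braiding on `g`. -/
def centralCoaction {g : C} (b : HalfBraiding g) (c : C) : g ⟶ (c ⊗ g) ⊗ cᘁ :=
  tensorRightHomEquiv g c cᘁ (c ⊗ g) (b.β c).hom

/-- The component `c ⊗ h ⊗ ᘁc ⟶ h` at `c` of the action of the central monad
`∫^c c ⊗ - ⊗ ᘁc` on `h` which corresponds to a half-braiding on `h`. -/
def centralAction {h : C} (b : HalfBraiding h) (c : C) : (c ⊗ h) ⊗ (ᘁc : C) ⟶ h :=
  (tensorRightHomEquiv (c ⊗ h) (ᘁc : C) c h).symm (b.β c).inv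

/-- Central integration (end): `T` is a functor with a bimodule functor structure `φ` and `j` the
dinatural family of its end `g`. The half-braiding `b` on `g` is the one for which the coaction
`g ⟶ c ⊗ g ⊗ cᘁ` is induced by the family `φ ∘ j_{c.m} : g ⟶ c ⊗ T(m,m) ⊗ cᘁ`. -/
def IsCentralEnd {T : Mᵒᵖ ⥤ M ⥤ C}
    (φ : ∀ (c c' : C) (m m' : M),
      (T.obj (op (c ⊙ₗ m))).obj (c' ⊙ₗ m') ≅ (c' ⊗ (T.obj (op m)).obj m') ⊗ cᘁ)
    {g : C} (j : ∀ m : M, g ⟶ (T.obj (op m)).obj m) (b : HalfBraiding g) : Prop :=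
  ∀ (c : C) (m : M),
    centralCoaction b c ≫ (c ◁ j m) ▷ cᘁ = j (c ⊙ₗ m) ≫ (φ c c m m).hom

/-- Central integration (coend): `T` is a functor with a bimodule functor structure `φ` and `i` the
dinatural family of its coend `h`. The half-braiding `b` on `h` is the one for which the action
`c ⊗ h ⊗ ᘁc ⟶ h` is induced by the family `i_{c.m} ∘ φ : c ⊗ T(m,m) ⊗ ᘁc ⟶ h`. -/
def IsCentralCoend {T : Mᵒᵖ ⥤ M ⥤ C}
    (φ : ∀ (c c' : C) (m m' : M),
      (c' ⊗ (T.obj (op m)).obj m') ⊗ (ᘁc : C) ≅ (T.obj (op (c ⊙ₗ m))).obj (c' ⊙ₗ m'))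
    {h : C} (i : ∀ m : M, (T.obj (op m)).obj m ⟶ h) (b : HalfBraiding h) : Prop :=
  ∀ (c : C) (m : M),
    (c ◁ i m) ▷ (ᘁc : C) ≫ centralAction b c = (φ c c m m).hom ≫ i (c ⊙ₗ m)

end CentralIntegration

section NatBifunctors

open Functor.LeftLinear

variable {C : Type u₁} [Category.{v₁} C] [MonoidalCategory C]
  {M : Type u₂} [Category.{v₂} M] [MonoidalLeftAction C M]
  {N : Type u₃} [Category.{v₃} N] [MonoidalLeftAction C N]

/-- The functor `(m, m') ↦ ihom(F m, G m')`. -/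
abbrev InternalHom.pullback (H : InternalHom C N) (F G : M ⥤ N) : Mᵒᵖ ⥤ M ⥤ C :=
  F.op ⋙ H.hom ⋙ (Functor.whiskeringLeft M N C).obj G

/-- The functor `(m, m') ↦ icohom(F m, G m')`. -/
abbrev InternalCohom.pullback (H : InternalCohom C N) (F G : M ⥤ N) : Mᵒᵖ ⥤ M ⥤ C :=
  F.op ⋙ H.cohom ⋙ (Functor.whiskeringLeft M N C).obj G

variable [RigidCategory C]

/-- For module functors `F` and `G`, the bimodule functor structure
`ihom(F(c.m), G(c'.m')) ≅ ihom(c.F m, c'.G m') ≅ c' ⊗ ihom(F m, G m') ⊗ cᘁ`. -/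
def InternalHom.pullbackBimoduleIso (H : InternalHom C N) (F G : M ⥤ N) [F.LeftLinear C]
    [G.LeftLinear C] (c c' : C) (m m' : M) :
    ((H.pullback F G).obj (op (c ⊙ₗ m))).obj (c' ⊙ₗ m') ≅
      (c' ⊗ ((H.pullback F G).obj (op m)).obj m') ⊗ cᘁ :=
  (H.hom.mapIso (μₗIso F c m).op).app (G.obj (c' ⊙ₗ m')) ≪≫
    (H.hom.obj (op (c ⊙ₗ F.obj m))).mapIso (μₗIso G c' m').symm ≪≫
      H.bimoduleIso c c' (F.obj m) (G.obj m')

/-- For module functors `F` and `G`, the bimodule functor structure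
`c' ⊗ icohom(F m, G m') ⊗ ᘁc ≅ icohom(c.F m, c'.G m') ≅ icohom(F(c.m), G(c'.m'))`. -/
def InternalCohom.pullbackBimoduleIso (H : InternalCohom C N) (F G : M ⥤ N) [F.LeftLinear C]
    [G.LeftLinear C] (c c' : C) (m m' : M) :
    (c' ⊗ ((H.pullback F G).obj (op m)).obj m') ⊗ (ᘁc : C) ≅
      ((H.pullback F G).obj (op (c ⊙ₗ m))).obj (c' ⊙ₗ m') :=
  H.bimoduleIso c c' (F.obj m) (G.obj m') ≪≫
    (H.cohom.mapIso (μₗIso F c m).symm.op).app (c' ⊙ₗ G.obj m') ≪≫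
      (H.cohom.obj (op (F.obj (c ⊙ₗ m)))).mapIso (μₗIso G c' m')

end NatBifunctors

/-! Everything rests on one reformulation. Transposing along `Hom(x, ihom(F m, G m)) ≃ Hom(x.F m, G
m)` turns wedges with vertex `x` into natural families `x.F(m) ⟶ G(m)`. The end is therefore an
object `g` with a universal such family (`IsUniversalEv`), representing `x ↦ Nat(x.F, G)`. Dually,
the coend represents `x ↦ Nat(G, x.F)` (`IsUniversalCoev`).

Existence. A finite category has a projective `P` covering every object, with all Hom spaces
finite-dimensional. A natural transformation from a right exact functor to an additive one is the
same as a morphism at `P` commuting with `End(P)` (`natTrans_ext`, `exists_natTrans`), and finitely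
many endomorphisms suffice by linearity. So `g` is the kernel of a morphism from `ihom(F P, G P)` to
a finite direct sum, and the coend is a cokernel. The internal Hom of `N` exists because `c ↦ c.m`
is right exact and linear, hence has a right adjoint (`exists_universal`). The internal coHom
follows by rigidity (`nonempty_internalCohom`).

Half-braiding. By duality `c ⊗ g` is universal for families `x.F(m) ⟶ c.G(m)`. The constraints of
`F` and `G` give such a family `(g ⊗ c).F(m) ≅ g.F(c.m) ⟶ G(c.m) ≅ c.G(m)`, hence a unique morphism
`g ⊗ c ⟶ c ⊗ g`. Naturality, the unit law and the hexagon follow from uniqueness, and invertibility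
is automatic in a rigid category (`HalfBraiding.ofLax`). Written through duals, the defining
equation is that of central integration (`isCentralEnd_iff`).

Comparison. A morphism `x ⟶ g` respects half-braidings exactly when its family is a module
transformation (`isModuleNat_comp_iff`). So `g` with its half-braiding represents `z ↦ Hom(z.F, G)`
on the center. This gives both the existence of the internal Hom there and, by Yoneda, the unique
isomorphism with any chosen one. -/

/-! ### Progenerators of finite linear categories -/

section Progenerator

/-- A projective object of a `k`-linear category with finite-dimensional spaces of morphisms and
such that every object is covered by a finite family of morphisms from it. -/
structure IsFiniteProgenerator (k : Type w) [Field k] {D : Type u₁} [Category.{v₁} D]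
    [Preadditive D] [Linear k D] (P : D) : Prop where
  projective : Projective P
  finite_hom (X : D) : Module.Finite k (P ⟶ X)
  exists_cover (X : D) : ∃ (n : ℕ) (p : Fin n → (P ⟶ X)),
    ∀ (Y : D) (f : X ⟶ Y), (∀ i, p i ≫ f = 0) → f = 0

/-- A map is determined by its values on finitely many generators of `V`, so `Hom(V, W)` embeds
`k`-linearly into a finite power of `W`, which is finite over `k` because `A` is. -/
lemma FGModuleCat.finite_hom (k : Type w) [Field k] {A : Type w} [Ring A] [Algebra k A]
    [Module.Finite k A] (V W : FGModuleCat.{w} A) : Module.Finite k (V ⟶ W) := by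
  obtain ⟨n, s, hs⟩ := Module.Finite.exists_fin (R := A) (M := V)
  let : Module k W := Module.compHom W (algebraMap k A)
  have : IsScalarTower k A W := ⟨fun r a x => by
    change (r • a) • x = algebraMap k A r • a • x
    rw [Algebra.smul_def, mul_smul]⟩
  have : Module.Finite k W := Module.Finite.trans A W
  let φ : (V ⟶ W) →ₗ[k] (Fin n → W) :=
    { toFun := fun f i => f.hom.hom (s i)
      map_add' := fun f g => rfl
      map_smul' := fun r f => rfl }
  refine Module.Finite.of_injective φ fun f g h => ?_
  ext x
  exact LinearMap.congr_fun (LinearMap.ext_on_range hs fun i => congrFun h i) x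

/-- The quotient of `W` by the range is again finitely generated, so the usual cokernel argument
stays inside `FGModuleCat` over any ring. -/
lemma FGModuleCat.surjective_of_epi {A : Type w} [Ring A] {V W : FGModuleCat.{w} A} (f : V ⟶ W)
    [Epi f] : Function.Surjective f.hom.hom := by
  rw [← LinearMap.range_eq_top]
  let Q : FGModuleCat.{w} A := FGModuleCat.of A (W ⧸ LinearMap.range f.hom.hom)
  let q : W ⟶ Q := FGModuleCat.ofHom (LinearMap.range f.hom.hom).mkQ
  have h : q = 0 := by
    rw [← cancel_epi f, comp_zero]
    ext x
    exact (Submodule.Quotient.mk_eq_zero _).2 ⟨x, rfl⟩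
  rw [eq_top_iff]
  intro x _
  have hx : q.hom.hom x = 0 := by rw [h]; rfl
  exact (Submodule.Quotient.mk_eq_zero _).1 hx

lemma FGModuleCat.projective_self (A : Type w) [Ring A] :
    Projective (FGModuleCat.of A A : FGModuleCat.{w} A) where
  factors {E X} f e _ := by
    obtain ⟨x, hx⟩ := FGModuleCat.surjective_of_epi e (f.hom.hom (1 : A))
    refine ⟨FGModuleCat.ofHom (LinearMap.toSpanSingleton A E x), ?_⟩
    ext
    change e.hom.hom ((1 : A) • x) = f.hom.hom (1 : A)
    rw [one_smul, hx]

lemma FGModuleCat.isFiniteProgenerator (k A : Type w) [Field k] [Ring A] [Algebra k A]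
    [Module.Finite k A] :
    IsFiniteProgenerator k (FGModuleCat.of A A : FGModuleCat.{w} A) where
  projective := FGModuleCat.projective_self A
  finite_hom X := FGModuleCat.finite_hom k _ X
  exists_cover X := by
    obtain ⟨n, s, hs⟩ := Module.Finite.exists_fin (R := A) (M := X)
    refine ⟨n, fun i => FGModuleCat.ofHom (LinearMap.toSpanSingleton A X (s i)), fun Y f h => ?_⟩
    ext x
    refine LinearMap.congr_fun (LinearMap.ext_on_range hs fun i => ?_) x
    have := congrArg (fun t => t.hom.hom (1 : A)) (h i)
    change f.hom.hom ((1 : A) • s i) = 0 at this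
    rwa [one_smul] at this

section

variable (k : Type w) [Field k] (D : Type u₁) [Category.{v₁} D]
    [Preadditive D] [Linear k D] [IsFiniteLinearCategory k D]

variable {D} in
lemma IsFiniteLinearCategory.finite_hom (X Y : D) : Module.Finite k (X ⟶ Y) := by
  obtain ⟨A, _, _, _, e, _, _⟩ := IsFiniteLinearCategory.exists_equivalence (k := k) (D := D)
  have := FGModuleCat.finite_hom k (e.functor.obj X) (e.functor.obj Y)
  exact Module.Finite.of_injective (e.functor.mapLinearMap k (X := X) (Y := Y))
    e.functor.map_injective

lemma IsFiniteLinearCategory.exists_progenerator : ∃ P : D, IsFiniteProgenerator k P := by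
  obtain ⟨A, _, _, _, e, _, _⟩ := IsFiniteLinearCategory.exists_equivalence (k := k) (D := D)
  -- The progenerator is the regular module, transported along the equivalence.
  have hA := FGModuleCat.isFiniteProgenerator k A
  refine ⟨e.inverse.obj (FGModuleCat.of A A),
    e.symm.toAdjunction.map_projective _ hA.projective,
    fun X => IsFiniteLinearCategory.finite_hom k _ _, fun X => ?_⟩
  obtain ⟨n, p, hp⟩ := hA.exists_cover (e.functor.obj X)
  refine ⟨n, fun i => e.inverse.map (p i) ≫ e.unitIso.inv.app X, fun Y f h => ?_⟩
  apply e.functor.map_injective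
  rw [Functor.map_zero]
  refine hp _ _ fun i => ?_
  apply e.inverse.map_injective
  have := h i
  simp only [Functor.map_comp, Category.assoc, Functor.map_zero, Equivalence.inv_fun_map] at this ⊢
  have h2 := this =≫ e.unit.app Y
  simpa using h2

end

end Progenerator

/-! ### Right exact functors are controlled by a progenerator -/

section RightExact

attribute [local instance] Abelian.hasFiniteBiproducts

variable {k : Type w} [Field k] {D : Type u₁} [Category.{v₁} D] [Abelian D] [Linear k D]
  {E : Type u₂} [Category.{v₂} E] [Abelian E]
  {P : D} (hP : IsFiniteProgenerator k P)

lemma epi_biproduct_desc {X : D} {n : ℕ} (p : Fin n → (P ⟶ X))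
    (hp : ∀ (Y : D) (f : X ⟶ Y), (∀ i, p i ≫ f = 0) → f = 0) : Epi (biproduct.desc p) :=
  Preadditive.epi_of_cancel_zero _ fun g hg => hp _ g fun i => by
    rw [← biproduct.ι_desc p i, Category.assoc, hg, comp_zero]

include hP in
/-- Every morphism from `P` factors through a cover by powers of `P`. -/
lemma IsFiniteProgenerator.exists_factor {X : D} {n : ℕ} (p : Fin n → (P ⟶ X))
    [Epi (biproduct.desc p)] (f : P ⟶ X) : ∃ q : Fin n → (P ⟶ P), ∑ i, q i ≫ p i = f := by
  have := hP.projective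
  refine ⟨fun i => Projective.factorThru f (biproduct.desc p) ≫ biproduct.π _ i, ?_⟩
  simp only [Category.assoc, ← Preadditive.comp_sum, ← biproduct.desc_eq,
    Projective.factorThru_comp]

/-- A right exact functor keeps the cover `P^n ⟶ X` epi, and additivity expands its image into the
components `F.map (p i)`. -/
lemma Functor.hom_ext_of_cover (F : D ⥤ E) [F.Additive] [PreservesFiniteColimits F] {X : D}
    {n : ℕ} (p : Fin n → (P ⟶ X)) [Epi (biproduct.desc p)] {Z : E} {a b : F.obj X ⟶ Z}
    (h : ∀ i, F.map (p i) ≫ a = F.map (p i) ≫ b) : a = b := by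
  rw [← cancel_epi (F.map (biproduct.desc p)), biproduct.desc_eq, F.map_sum]
  simp only [F.map_comp, Preadditive.sum_comp, Category.assoc, h]

include hP in
-- By right exactness `F X` is the cokernel of `F (ker π) ⟶ F (P^n)`. The kernel is itself covered
-- by copies of `P`, so only relations with coefficients in `End(P)` need to be tested.
lemma IsFiniteProgenerator.exists_desc (F : D ⥤ E) [F.Additive] [PreservesFiniteColimits F]
    {X : D} {n : ℕ} (p : Fin n → (P ⟶ X)) [Epi (biproduct.desc p)] {Z : E}
    (t : Fin n → (F.obj P ⟶ Z))
    (ht : ∀ q : Fin n → (P ⟶ P), ∑ i, q i ≫ p i = 0 → ∑ i, F.map (q i) ≫ t i = 0) :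
    ∃ d : F.obj X ⟶ Z, ∀ i, F.map (p i) ≫ d = t i := by
  set π := biproduct.desc p
  obtain ⟨l, r, hr⟩ := hP.exists_cover (kernel π)
  have := epi_biproduct_desc r hr
  let t' : F.obj (⨁ fun _ : Fin n => P) ⟶ Z := ∑ i, F.map (biproduct.π _ i) ≫ t i
  have h : F.map (kernel.ι π) ≫ t' = 0 := by
    refine Functor.hom_ext_of_cover F r fun j => ?_
    have := ht (fun i => r j ≫ kernel.ι π ≫ biproduct.π _ i) (by
      simp only [Category.assoc, ← Preadditive.comp_sum, ← biproduct.desc_eq]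
      rw [kernel.condition, comp_zero])
    rw [comp_zero, ← this]
    simp only [t', Preadditive.comp_sum, Functor.map_comp, Category.assoc]
  have hc := CokernelCofork.mapIsColimit _
    (Abelian.epiIsCokernelOfKernel _ (kernelIsKernel π)) F
  obtain ⟨d, hd'⟩ : ∃ d : F.obj X ⟶ Z, F.map π ≫ d = t' :=
    have ⟨d, hd⟩ := CokernelCofork.IsColimit.desc' hc t' h
    ⟨d, hd⟩
  refine ⟨d, fun i => ?_⟩
  rw [← biproduct.ι_desc p i, F.map_comp, Category.assoc, hd']
  simp only [t', Preadditive.comp_sum, ← F.map_comp_assoc, biproduct.ι_π]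
  rw [Finset.sum_eq_single i]
  · simp
  · intro j _ hj
    rw [dif_neg (Ne.symm hj), F.map_zero, zero_comp]
  · simp

include hP in
lemma IsFiniteProgenerator.natTrans_ext {F G : D ⥤ E} [F.Additive] [PreservesFiniteColimits F]
    {α β : F ⟶ G} (h : α.app P = β.app P) : α = β := by
  ext X
  obtain ⟨n, p, hp⟩ := hP.exists_cover X
  have := epi_biproduct_desc p hp
  exact Functor.hom_ext_of_cover F p fun i => by simp [h]

include hP in
/-- A natural transformation from a right exact functor to an additive functor can be prescribed
on a progenerator. -/
lemma IsFiniteProgenerator.exists_natTrans {F G : D ⥤ E} [F.Additive]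
    [PreservesFiniteColimits F] [G.Additive] (h : F.obj P ⟶ G.obj P)
    (hh : ∀ a : P ⟶ P, F.map a ≫ h = h ≫ G.map a) : ∃ α : F ⟶ G, α.app P = h := by
  -- The component at `X` is pinned down by all morphisms `P ⟶ X`, not only those of a chosen cover.
  -- This makes it independent of the cover and yields naturality.
  have key (X : D) : ∃ d : F.obj X ⟶ G.obj X, ∀ f : P ⟶ X, F.map f ≫ d = h ≫ G.map f := by
    obtain ⟨n, p, hp⟩ := hP.exists_cover X
    have := epi_biproduct_desc p hp
    obtain ⟨d, hd⟩ := hP.exists_desc F p (fun i => h ≫ G.map (p i)) (fun q hq => by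
      simp only [reassoc_of% hh, ← G.map_comp, ← Preadditive.comp_sum, ← G.map_sum, hq,
        G.map_zero, comp_zero])
    refine ⟨d, fun f => ?_⟩
    obtain ⟨q, rfl⟩ := hP.exists_factor p f
    simp only [F.map_sum, G.map_sum, F.map_comp, G.map_comp, Preadditive.sum_comp,
      Preadditive.comp_sum, Category.assoc, hd, reassoc_of% hh]
  choose d hd using key
  refine ⟨{ app := d, naturality := fun X Y f => ?_ }, by simpa using hd P (𝟙 P)⟩
  obtain ⟨n, p, hp⟩ := hP.exists_cover X
  have := epi_biproduct_desc p hp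
  refine Functor.hom_ext_of_cover F p fun i => ?_
  rw [← F.map_comp_assoc, hd, reassoc_of% hd, G.map_comp]

variable [Linear k E]

include hP in
/-- A right exact `k`-linear functor `L` has a right adjoint: a universal morphism from `L` to
any object. -/
lemma IsFiniteProgenerator.exists_universal (L : D ⥤ E) [L.Additive] [L.Linear k]
    [PreservesFiniteColimits L] (Y : E) [Module.Finite k (L.obj P ⟶ Y)] :
    ∃ (R : D) (ε : L.obj R ⟶ Y), ∀ (X : D) (f : L.obj X ⟶ Y), ∃! g : X ⟶ R, L.map g ≫ ε = f := by
  -- First approximation to the right adjoint: a power `B` of `P`, one copy for each generator of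
  -- `Hom(L P, Y)`, so that every `L P ⟶ Y` factors through `φ'`.
  obtain ⟨d, φ, hφ⟩ := Module.Finite.exists_fin (R := k) (M := (L.obj P ⟶ Y))
  let B : D := ⨁ fun _ : Fin d => P
  let φ' : L.obj B ⟶ Y := ∑ i, L.map (biproduct.π _ i) ≫ φ i
  have hφ' (f : L.obj P ⟶ Y) : ∃ g : P ⟶ B, L.map g ≫ φ' = f := by
    have hf : f ∈ Submodule.span k (Set.range φ) := hφ ▸ Submodule.mem_top
    obtain ⟨c, rfl⟩ := (Submodule.mem_span_range_iff_exists_fun k).1 hf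
    refine ⟨biproduct.lift fun i => c i • 𝟙 P, ?_⟩
    simp only [φ', Preadditive.comp_sum, ← L.map_comp_assoc, biproduct.lift_π, L.map_smul,
      L.map_id, Linear.smul_comp, Category.id_comp]
  -- `W` measures the failure of uniqueness. Dividing `B` by the images of all its members leaves an
  -- object `R` with `Hom(P, R) ≅ Hom(P, B)/W ≅ Hom(L P, Y)`, `P` being projective.
  let W : Submodule k (P ⟶ B) :=
    LinearMap.ker ((Linear.rightComp k (L.obj P) φ').comp (L.mapLinearMap k (X := P) (Y := B)))
  have := hP.finite_hom B
  obtain ⟨n, s, hs⟩ := Module.Finite.exists_fin (R := k) (M := W)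
  have hW (f : P ⟶ B) : f ∈ W ↔ L.map f ≫ φ' = 0 := Iff.rfl
  let ω := biproduct.desc fun i => (s i : P ⟶ B)
  have hω : L.map ω ≫ φ' = 0 := by
    simp only [ω, biproduct.desc_eq, L.map_sum, Preadditive.sum_comp, L.map_comp, Category.assoc,
      (hW _).1 (s _).2, comp_zero, Finset.sum_const_zero]
  have hc := CokernelCofork.mapIsColimit _ (cokernelIsCokernel ω) L
  obtain ⟨ε, hε⟩ : ∃ ε : L.obj (cokernel ω) ⟶ Y, L.map (cokernel.π ω) ≫ ε = φ' :=
    have ⟨ε, hε⟩ := CokernelCofork.IsColimit.desc' hc φ' hω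
    ⟨ε, hε⟩
  have hfac (f : P ⟶ B) (hf : f ∈ W) : f ≫ cokernel.π ω = 0 := by
    have h1 : (⟨f, hf⟩ : W) ∈ Submodule.span k (Set.range s) := hs ▸ Submodule.mem_top
    obtain ⟨c, hc⟩ := (Submodule.mem_span_range_iff_exists_fun k).1 h1
    have h2 : f = ∑ i, c i • (s i : P ⟶ B) := by
      have := congrArg Subtype.val hc
      simpa using this.symm
    rw [h2, Preadditive.sum_comp]
    refine Finset.sum_eq_zero fun i _ => ?_
    have : (s i : P ⟶ B) = biproduct.ι (fun _ : Fin n => P) i ≫ ω := by simp [ω]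
    rw [Linear.smul_comp, this, Category.assoc, cokernel.condition, comp_zero, smul_zero]
  have huniqP (f : P ⟶ cokernel ω) (hf : L.map f ≫ ε = 0) : f = 0 := by
    have := hP.projective
    rw [← Projective.factorThru_comp f (cokernel.π ω)]
    apply hfac
    rw [hW, ← hε, ← L.map_comp_assoc, Projective.factorThru_comp, hf]
  have huniq {X : D} (f : X ⟶ cokernel ω) (hf : L.map f ≫ ε = 0) : f = 0 := by
    obtain ⟨n, p, hp⟩ := hP.exists_cover X
    have := epi_biproduct_desc p hp
    refine Functor.hom_ext_of_cover (𝟭 D) p fun i => ?_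
    simp only [Functor.id_map, comp_zero]
    exact huniqP _ (by rw [L.map_comp, Category.assoc, hf, comp_zero])
  refine ⟨cokernel ω, ε, fun X f => ?_⟩
  obtain ⟨n, p, hp⟩ := hP.exists_cover X
  have := epi_biproduct_desc p hp
  choose g hg using fun i => hφ' (L.map (p i) ≫ f)
  -- The factorizations over the members of the cover glue, because the relations between them hold
  -- after applying `L` and composing with `ε`, and `huniq` detects zero there.
  obtain ⟨g', hg'⟩ : ∃ g' : X ⟶ cokernel ω, ∀ i, p i ≫ g' = g i ≫ cokernel.π ω :=
    hP.exists_desc (𝟭 D) p (fun i => g i ≫ cokernel.π ω) (fun q hq => by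
    refine huniq _ ?_
    simp only [Functor.id_map, L.map_sum, L.map_comp, Preadditive.sum_comp, Category.assoc, hε, hg]
    simp only [← L.map_comp_assoc, ← Preadditive.sum_comp, ← L.map_sum, hq]
    simp)
  have hg'' : L.map g' ≫ ε = f := Functor.hom_ext_of_cover L p fun i => by
    rw [← L.map_comp_assoc, hg', L.map_comp, Category.assoc, hε, hg]
  refine ⟨g', hg'', fun y hy => ?_⟩
  rw [← sub_eq_zero]
  refine huniq _ ?_
  have hy' : L.map y ≫ ε = f := hy
  rw [L.map_sub, Preadditive.sub_comp, hy', hg'', sub_self]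

end RightExact

/-! ### Internal Homs and coHoms from universal morphisms -/

section Universal

variable {C : Type u₁} [Category.{v₁} C] [MonoidalCategory C]
  {M : Type u₂} [Category.{v₂} M] [MonoidalLeftAction C M]

/-- An internal Hom exists as soon as all the functors `Hom(-.m, m')` are representable. -/
theorem InternalHom.nonempty_of_universal
    (h : ∀ m m' : M, ∃ (R : C) (ε : R ⊙ₗ m ⟶ m'), ∀ (c : C) (f : c ⊙ₗ m ⟶ m'),
      ∃! g : c ⟶ R, g ⊵ₗ m ≫ ε = f) : Nonempty (InternalHom C M) := by
  choose R ε hε using h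
  choose l hl using fun m m' c f => (hε m m' c f).exists
  have hext {m m' : M} {c : C} {g g' : c ⟶ R m m'} (e : g ⊵ₗ m ≫ ε m m' = g' ⊵ₗ m ≫ ε m m') :
      g = g' := (hε m m' c _).unique e rfl
  -- Both functorialities are forced by the universal property; each law is checked after composing
  -- with `ε`.
  let G : Mᵒᵖ ⥤ M ⥤ C :=
    { obj := fun m =>
        { obj := fun m' => R m.unop m'
          map := fun {m' m''} f => l m.unop m'' _ (ε _ _ ≫ f)
          map_id := fun m' => hext (by simp [hl])
          map_comp := fun f g => hext (by simp [hl, reassoc_of% hl]) }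
      map := fun {m n} f =>
        { app := fun m' => l n.unop m' _ (_ ⊴ₗ f.unop ≫ ε _ _)
          naturality := fun m' m'' g => hext (by
            simp only [comp_actionHomLeft, hl, reassoc_of% hl, Category.assoc]
            rw [← action_exchange_assoc, hl]) }
      map_id := fun m => by
        ext m'
        exact hext (by simp [hl])
      map_comp := fun f g => by
        ext m'
        refine hext ?_
        simp [hl]
        rw [← action_exchange_assoc, hl] }
  have hr {m m' m'' : M} {c : C} (f : c ⊙ₗ m ⟶ m') (g : m' ⟶ m'') :
      l m m'' c (f ≫ g) = l m m' c f ≫ l m m'' _ (ε m m' ≫ g) :=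
    hext (by rw [comp_actionHomLeft, Category.assoc, hl, hl, reassoc_of% hl])
  have hm {m n m' : M} {c : C} (f : m ⟶ n) (g : c ⊙ₗ n ⟶ m') :
      l m m' c (c ⊴ₗ f ≫ g) = l n m' c g ≫ l m m' _ (R n m' ⊴ₗ f ≫ ε n m') :=
    hext (by rw [hl, comp_actionHomLeft, Category.assoc, hl, ← action_exchange_assoc, hl])
  let adj (m : M) : (curriedAction C M).flip.obj m ⊣ G.obj (op m) :=
    Adjunction.mkOfHomEquiv
      { homEquiv := fun c m' =>
          { toFun := fun f => l m m' c f
            invFun := fun g => g ⊵ₗ m ≫ ε m m'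
            left_inv := fun f => hl m m' c f
            right_inv := fun g => hext (hl _ _ _ _) }
        homEquiv_naturality_left_symm := fun f g => by
          change (f ≫ g) ⊵ₗ m ≫ _ = f ⊵ₗ m ≫ g ⊵ₗ m ≫ _
          simp
        homEquiv_naturality_right := fun f g => hr f g }
  have hadj {m : M} {c : C} {m' : M} (f : c ⊙ₗ m ⟶ m') : (adj m).homEquiv c m' f = l m m' c f := by
    rw [Adjunction.mkOfHomEquiv_homEquiv]
    rfl
  exact ⟨⟨G, ParametrizedAdjunction.mk' adj fun {m n} f {c m'} g =>
    (hadj _).trans ((hm f g).trans (congrArg (· ≫ (G.map f.op).app m') (hadj g)).symm)⟩⟩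

/-- An internal coHom exists as soon as all the functors `Hom(m, -.m')` are corepresentable. -/
theorem InternalCohom.nonempty_of_universal
    (h : ∀ m' m : M, ∃ (R : C) (ε : m ⟶ R ⊙ₗ m'), ∀ (c : C) (f : m ⟶ c ⊙ₗ m'),
      ∃! g : R ⟶ c, ε ≫ g ⊵ₗ m' = f) : Nonempty (InternalCohom C M) := by
  choose R ε hε using h
  choose l hl using fun m' m c f => (hε m' m c f).exists
  have hext {m' m : M} {c : C} {g g' : R m' m ⟶ c} (e : ε m' m ≫ g ⊵ₗ m' = ε m' m ≫ g' ⊵ₗ m') :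
      g = g' := (hε m' m c _).unique e rfl
  have hl_assoc {m' m : M} {c : C} (f : m ⟶ c ⊙ₗ m') {c' : M} (g : c ⊙ₗ m' ⟶ c') :
      ε m' m ≫ l m' m c f ⊵ₗ m' ≫ g = f ≫ g := by
    rw [← Category.assoc, hl]
  let G : Mᵒᵖ ⥤ M ⥤ C :=
    { obj := fun m' =>
        { obj := fun m => R m'.unop m
          map := fun {m n} f => l m'.unop m _ (f ≫ ε _ _)
          map_id := fun m' => hext (by simp [hl])
          map_comp := fun f g => hext (by simp [hl, hl_assoc]) }
      map := fun {m' n'} f =>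
        { app := fun m => l m'.unop m _ (ε _ _ ≫ _ ⊴ₗ f.unop)
          naturality := fun m n g => hext (by
            simp only [comp_actionHomLeft, hl, hl_assoc, Category.assoc]
            rw [action_exchange, hl_assoc, Category.assoc]) }
      map_id := fun m => by
        ext m'
        exact hext (by simp [hl])
      map_comp := fun f g => by
        ext m'
        refine hext ?_
        change ε _ _ ≫ l _ _ _ _ ⊵ₗ _ = ε _ _ ≫ (l _ _ _ _ ≫ l _ _ _ _) ⊵ₗ _
        simp only [comp_actionHomLeft, hl, hl_assoc, Category.assoc, unop_comp,
          actionHomRight_comp]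
        rw [action_exchange, hl_assoc, Category.assoc] }
  have hr {m' m n : M} {c : C} (f : m ⟶ n) (g : n ⟶ c ⊙ₗ m') :
      l m' m c (f ≫ g) = l m' m _ (f ≫ ε m' n) ≫ l m' n c g :=
    hext (by rw [comp_actionHomLeft, hl_assoc, hl, Category.assoc, hl])
  let adj (m' : Mᵒᵖ) : G.obj m' ⊣ (unopUnop M ⋙ (curriedAction C M).flip).obj (op m') :=
    Adjunction.mkOfHomEquiv
      { homEquiv := fun m c =>
          { toFun := fun g => ε m'.unop m ≫ g ⊵ₗ m'.unop
            invFun := fun f => l m'.unop m c f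
            left_inv := fun g => hext (hl _ _ _ _)
            right_inv := fun f => hl _ _ _ _ }
        homEquiv_naturality_left_symm := fun f g => hr f g
        homEquiv_naturality_right := fun f g => by
          change _ ≫ (f ≫ g) ⊵ₗ _ = (_ ≫ f ⊵ₗ _) ≫ g ⊵ₗ _
          simp }
  have hadj {m' : Mᵒᵖ} {m : M} {c : C} (g : R m'.unop m ⟶ c) :
      (adj m').homEquiv m c g = ε m'.unop m ≫ g ⊵ₗ m'.unop := by
    rw [Adjunction.mkOfHomEquiv_homEquiv]
    rfl
  refine ⟨⟨G, ParametrizedAdjunction.mk' adj fun {m' n'} f {m c} g => ?_⟩⟩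
  refine (hadj _).trans (Eq.trans ?_ (congrArg (· ≫ c ⊴ₗ f.unop) (hadj g)).symm)
  change ε m'.unop m ≫ (l _ _ _ _ ≫ g) ⊵ₗ m'.unop = (ε n'.unop m ≫ g ⊵ₗ n'.unop) ≫ c ⊴ₗ f.unop
  simp only [comp_actionHomLeft, hl_assoc, Category.assoc]
  rw [action_exchange]

/-- The universal morphism of an internal Hom. -/
abbrev InternalHom.ev (H : InternalHom C M) (m m' : M) : H.ihom m m' ⊙ₗ m ⟶ m' :=
  (H.homEquiv _ m m').symm (𝟙 _)

lemma InternalHom.homEquiv_symm_eq (H : InternalHom C M) {c : C} {m m' : M}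
    (f : c ⟶ H.ihom m m') : (H.homEquiv c m m').symm f = f ⊵ₗ m ≫ H.ev m m' := by
  rw [← H.homEquiv_symm_naturality, Category.comp_id]

/-- The universal morphism of an internal coHom. -/
abbrev InternalCohom.coev (H : InternalCohom C M) (m' m : M) : m ⟶ H.icohom m' m ⊙ₗ m' :=
  H.homEquiv m' m _ (𝟙 _)

lemma InternalCohom.homEquiv_eq (H : InternalCohom C M) {c : C} {m' m : M}
    (f : H.icohom m' m ⟶ c) : H.homEquiv m' m c f = H.coev m' m ≫ f ⊵ₗ m' := by
  rw [← H.homEquiv_naturality, Category.id_comp]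

section Mates

variable {X X' Y Y' : C} [ExactPairing X X'] [ExactPairing Y Y']

/-- The assignment is the duality bijection `Hom(X, Z) ≃ Hom(𝟙, Z ⊗ X')`, up to a unitor. -/
lemma ExactPairing.coevaluation_whiskerRight_injective {Z : C} {g g' : X ⟶ Z}
    (h : η_ X X' ≫ g ▷ X' = η_ X X' ≫ g' ▷ X') : g = g' := by
  have := congrArg (tensorRightHomEquiv (𝟙_ C) X X' Z).symm h
  simpa only [tensorRightHomEquiv_symm_coevaluation_comp_whiskerRight, cancel_epi] using this

lemma ExactPairing.exists_mate (f : 𝟙_ C ⟶ Y ⊗ X') : ∃ g : X ⟶ Y, η_ X X' ≫ g ▷ X' = f := by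
  refine ⟨(λ_ X).inv ≫ (tensorRightHomEquiv (𝟙_ C) X X' Y).symm f, ?_⟩
  apply (tensorRightHomEquiv (𝟙_ C) X X' Y).symm.injective
  rw [tensorRightHomEquiv_symm_coevaluation_comp_whiskerRight, Iso.hom_inv_id_assoc]

lemma ExactPairing.exists_mate' (f : 𝟙_ C ⟶ Y ⊗ X') : ∃ g : Y' ⟶ X', η_ Y Y' ≫ Y ◁ g = f := by
  refine ⟨(ρ_ Y').inv ≫ (tensorLeftHomEquiv (𝟙_ C) Y Y' X').symm f, ?_⟩
  apply (tensorLeftHomEquiv (𝟙_ C) Y Y' X').symm.injective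
  rw [tensorLeftHomEquiv_symm_coevaluation_comp_whiskerLeft, Iso.hom_inv_id_assoc]

/-- The hypothesis says that `g` and `g'` are mates, having the same name `𝟙 ⟶ Y ⊗ X'`. The duality
bijection for the action exchanges composition with `g` and composition with its mate. -/
lemma actionHomEquiv_comp_of_mate {g : X ⟶ Y} {g' : Y' ⟶ X'}
    (h : η_ X X' ≫ g ▷ X' = η_ Y Y' ≫ Y ◁ g') {m m' : M} (u : X' ⊙ₗ m ⟶ m') :
    actionHomEquiv X X' m m' u ≫ g ⊵ₗ m' = actionHomEquiv Y Y' m m' (g' ⊵ₗ m ≫ u) := by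
  have h' := congrArg (fun t => t ⊵ₗ m ≫ (αₗ Y X' m).hom) h
  simp only [comp_actionHomLeft, whiskerRight_actionHomLeft, whiskerLeft_actionHomLeft,
    Category.assoc, Iso.inv_hom_id, Category.comp_id] at h'
  simp only [actionHomEquiv, Equiv.coe_fn_mk, Category.assoc, actionHomRight_comp]
  rw [action_exchange, reassoc_of% h']

end Mates

/-- In a rigid category an internal Hom provides an internal coHom, by
`Hom(m, c.m') ≅ Hom(cᘁ.m, m') ≅ Hom(cᘁ, ihom(m, m')) ≅ Hom(ᘁihom(m, m'), c)`. -/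
theorem InternalHom.nonempty_internalCohom [RigidCategory C] (H : InternalHom C M) :
    Nonempty (InternalCohom C M) := by
  refine InternalCohom.nonempty_of_universal fun m' m =>
    ⟨(ᘁ(H.ihom m m') : C), actionHomEquiv _ (H.ihom m m') m m' (H.ev m m'), fun c f => ?_⟩
  refine existsUnique_of_exists_of_unique ?_ fun g₁ g₂ h₁ h₂ => ?_
  · obtain ⟨f, rfl⟩ := (actionHomEquiv c cᘁ m m').surjective f
    obtain ⟨g', rfl⟩ := (H.homEquiv _ m m').symm.surjective f
    obtain ⟨g, hg⟩ := ExactPairing.exists_mate (X := (ᘁ(H.ihom m m') : C)) (X' := H.ihom m m')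
      (η_ c cᘁ ≫ c ◁ g')
    exact ⟨g, by rw [actionHomEquiv_comp_of_mate hg, H.homEquiv_symm_eq]⟩
  -- Uniqueness is read off from the mates `cᘁ ⟶ ihom(m, m')`, where the internal Hom bijection
  -- applies.
  · obtain ⟨g₁', h₁'⟩ := ExactPairing.exists_mate' (Y' := cᘁ) (η_ _ _ ≫ g₁ ▷ H.ihom m m')
    obtain ⟨g₂', h₂'⟩ := ExactPairing.exists_mate' (Y' := cᘁ) (η_ _ _ ≫ g₂ ▷ H.ihom m m')
    have e : g₁' = g₂' := by
      apply (H.homEquiv _ m m').symm.injective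
      apply (actionHomEquiv c cᘁ m m').injective
      rw [H.homEquiv_symm_eq, H.homEquiv_symm_eq, ← actionHomEquiv_comp_of_mate h₁'.symm,
        ← actionHomEquiv_comp_of_mate h₂'.symm, h₁, h₂]
    exact ExactPairing.coevaluation_whiskerRight_injective (by rw [← h₁', ← h₂', e])

end Universal

section FiniteModule

variable (k : Type w) [Field k]
    (C : Type u₁) [Category.{v₁} C] [Abelian C] [Linear k C] [MonoidalCategory C]
    [IsFiniteLinearCategory k C]
    (N : Type u₃) [Category.{v₃} N] [Abelian N] [Linear k N] [MonoidalLeftAction C N]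
    [IsFiniteModuleCategory k C N]

include k in
-- The functor `c ↦ c.m` is linear and right exact on a finite category, and `Hom(P.m, m')` is
-- finite-dimensional, so the right adjoint `ihom(m, -)` exists.
theorem IsFiniteModuleCategory.nonempty_internalHom : Nonempty (InternalHom C N) := by
  obtain ⟨P, hP⟩ := IsFiniteLinearCategory.exists_progenerator k C
  refine InternalHom.nonempty_of_universal fun m m' => ?_
  have : (actionRight C m).Additive := IsFiniteModuleCategory.additive_actionRight k m
  have : (actionRight C m).Linear k := IsFiniteModuleCategory.linear_actionRight m
  have : PreservesFiniteColimits (actionRight C m) :=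
    IsFiniteModuleCategory.rightExact_actionRight k m
  have : Module.Finite k ((actionRight C m).obj P ⟶ m') := IsFiniteLinearCategory.finite_hom k _ _
  exact hP.exists_universal (actionRight C m) m'

end FiniteModule

/-! ### Automatic invertibility of half-braidings in a rigid category -/

section LaxHalfBraiding

variable {C : Type u₁} [Category.{v₁} C] [MonoidalCategory C] {X : C}

/-- In a rigid category a lax half-braiding is a half-braiding. -/
def HalfBraiding.ofLax [LeftRigidCategory C] (σ : ∀ U, X ⊗ U ⟶ U ⊗ X)
    (unit : σ (𝟙_ C) = (ρ_ X).hom ≫ (λ_ X).inv)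
    (monoidal : ∀ U V, σ (U ⊗ V) =
      (α_ X U V).inv ≫ σ U ▷ V ≫ (α_ U X V).hom ≫ U ◁ σ V ≫ (α_ U V X).inv)
    (naturality : ∀ {U V} (f : U ⟶ V), X ◁ f ≫ σ V = σ U ≫ f ▷ X) : HalfBraiding X where
  β U :=
    { hom := σ U
      -- The inverse at `U` is the mate of `σ` at the dual `ᘁU`.
      inv := 𝟙 _ ⊗≫ (U ⊗ X) ◁ η_ (ᘁU : C) U ⊗≫ U ◁ σ (ᘁU : C) ▷ U ⊗≫
        ε_ (ᘁU : C) U ▷ (X ⊗ U) ⊗≫ 𝟙 _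
      hom_inv_id := calc
        _ = 𝟙 _ ⊗≫ (σ U ▷ 𝟙_ C ≫ (U ⊗ X) ◁ η_ (ᘁU : C) U) ⊗≫ U ◁ σ (ᘁU : C) ▷ U ⊗≫
              ε_ (ᘁU : C) U ▷ (X ⊗ U) ⊗≫ 𝟙 _ := by monoidal
        _ = 𝟙 _ ⊗≫ (X ⊗ U) ◁ η_ (ᘁU : C) U ⊗≫ ((α_ X U (ᘁU)).inv ≫ σ U ▷ (ᘁU) ≫
              (α_ U X (ᘁU)).hom ≫ U ◁ σ (ᘁU) ≫ (α_ U (ᘁU) X).inv) ▷ U ⊗≫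
              ε_ (ᘁU : C) U ▷ X ▷ U ⊗≫ 𝟙 _ := by
            rw [← whisker_exchange]; monoidal
        -- The hexagon fuses the two braidings into one with `U ⊗ ᘁU`. Naturality along the
        -- evaluation and the unit law then remove it, leaving a zigzag identity.
        _ = 𝟙 _ ⊗≫ (X ⊗ U) ◁ η_ (ᘁU : C) U ⊗≫ (σ (U ⊗ (ᘁU)) ≫ ε_ (ᘁU : C) U ▷ X) ▷ U ⊗≫
              𝟙 _ := by
            rw [monoidal]; monoidal
        _ = 𝟙 _ ⊗≫ X ◁ (U ◁ η_ (ᘁU : C) U ⊗≫ ε_ (ᘁU : C) U ▷ U) ⊗≫ 𝟙 _ := by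
            rw [← naturality, unit]; monoidal
        _ = _ := by
            rw [ExactPairing.coevaluation_evaluation'']; monoidal
      inv_hom_id := calc
        _ = 𝟙 _ ⊗≫ (U ⊗ X) ◁ η_ (ᘁU : C) U ⊗≫ U ◁ σ (ᘁU : C) ▷ U ⊗≫
              (ε_ (ᘁU : C) U ▷ (X ⊗ U) ≫ 𝟙_ C ◁ σ U) ⊗≫ 𝟙 _ := by monoidal
        _ = 𝟙 _ ⊗≫ (U ⊗ X) ◁ η_ (ᘁU : C) U ⊗≫ U ◁ ((α_ X (ᘁU) U).inv ≫ σ (ᘁU) ▷ U ≫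
              (α_ (ᘁU) X U).hom ≫ (ᘁU) ◁ σ U ≫ (α_ (ᘁU) U X).inv) ⊗≫
              ε_ (ᘁU : C) U ▷ U ▷ X ⊗≫ 𝟙 _ := by
            rw [← whisker_exchange]; monoidal
        _ = 𝟙 _ ⊗≫ U ◁ (X ◁ η_ (ᘁU : C) U ≫ σ ((ᘁU) ⊗ U)) ⊗≫ ε_ (ᘁU : C) U ▷ U ▷ X ⊗≫
              𝟙 _ := by
            rw [monoidal]; monoidal
        _ = 𝟙 _ ⊗≫ (U ◁ η_ (ᘁU : C) U ⊗≫ ε_ (ᘁU : C) U ▷ U) ▷ X ⊗≫ 𝟙 _ := by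
            rw [naturality, unit]; monoidal
        _ = _ := by
            rw [ExactPairing.coevaluation_evaluation'']; monoidal }
  monoidal := monoidal
  naturality := naturality

/-- In a rigid category an oplax half-braiding consists of isomorphisms. -/
def oplaxHalfBraidingIso [RightRigidCategory C] (τ : ∀ U, U ⊗ X ⟶ X ⊗ U)
    (unit : τ (𝟙_ C) = (λ_ X).hom ≫ (ρ_ X).inv)
    (monoidal : ∀ U V, τ (U ⊗ V) =
      (α_ U V X).hom ≫ U ◁ τ V ≫ (α_ U X V).inv ≫ τ U ▷ V ≫ (α_ X U V).hom)
    (naturality : ∀ {U V} (f : U ⟶ V), f ▷ X ≫ τ V = τ U ≫ X ◁ f) (U : C) :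
    X ⊗ U ≅ U ⊗ X :=
    { inv := τ U
      -- Here the given morphism points the other way, so its inverse is the mate of `τ` at the
      -- right dual `Uᘁ`.
      hom := 𝟙 _ ⊗≫ η_ U (Uᘁ) ▷ (X ⊗ U) ⊗≫ U ◁ τ (Uᘁ) ▷ U ⊗≫ (U ⊗ X) ◁ ε_ U (Uᘁ) ⊗≫ 𝟙 _
      inv_hom_id := calc
        _ = 𝟙 _ ⊗≫ (𝟙_ C ◁ τ U ≫ η_ U (Uᘁ) ▷ (X ⊗ U)) ⊗≫ U ◁ τ (Uᘁ) ▷ U ⊗≫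
              (U ⊗ X) ◁ ε_ U (Uᘁ) ⊗≫ 𝟙 _ := by monoidal
        _ = 𝟙 _ ⊗≫ η_ U (Uᘁ) ▷ (U ⊗ X) ⊗≫ U ◁ ((α_ (Uᘁ) U X).hom ≫ (Uᘁ) ◁ τ U ≫
              (α_ (Uᘁ) X U).inv ≫ τ (Uᘁ) ▷ U ≫ (α_ X (Uᘁ) U).hom) ⊗≫
              U ◁ X ◁ ε_ U (Uᘁ) ⊗≫ 𝟙 _ := by
            rw [whisker_exchange]; monoidal
        _ = 𝟙 _ ⊗≫ η_ U (Uᘁ) ▷ (U ⊗ X) ⊗≫ U ◁ (τ (Uᘁ ⊗ U) ≫ X ◁ ε_ U (Uᘁ)) ⊗≫ 𝟙 _ := by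
            rw [monoidal]; monoidal
        _ = 𝟙 _ ⊗≫ (η_ U (Uᘁ) ▷ U ⊗≫ U ◁ ε_ U (Uᘁ)) ▷ X ⊗≫ 𝟙 _ := by
            rw [← naturality, unit]; monoidal
        _ = _ := by
            rw [ExactPairing.evaluation_coevaluation'']; monoidal
      hom_inv_id := calc
        _ = 𝟙 _ ⊗≫ η_ U (Uᘁ) ▷ (X ⊗ U) ⊗≫ U ◁ τ (Uᘁ) ▷ U ⊗≫
              ((U ⊗ X) ◁ ε_ U (Uᘁ) ≫ τ U ▷ 𝟙_ C) ⊗≫ 𝟙 _ := by monoidal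
        _ = 𝟙 _ ⊗≫ η_ U (Uᘁ) ▷ (X ⊗ U) ⊗≫ ((α_ U (Uᘁ) X).hom ≫ U ◁ τ (Uᘁ) ≫
              (α_ U X (Uᘁ)).inv ≫ τ U ▷ (Uᘁ) ≫ (α_ X U (Uᘁ)).hom) ▷ U ⊗≫
              (X ⊗ U) ◁ ε_ U (Uᘁ) ⊗≫ 𝟙 _ := by
            rw [whisker_exchange]; monoidal
        _ = 𝟙 _ ⊗≫ (η_ U (Uᘁ) ▷ X ≫ τ (U ⊗ Uᘁ)) ▷ U ⊗≫ (X ⊗ U) ◁ ε_ U (Uᘁ) ⊗≫ 𝟙 _ := by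
            rw [monoidal]; monoidal
        _ = 𝟙 _ ⊗≫ X ◁ (η_ U (Uᘁ) ▷ U ⊗≫ U ◁ ε_ U (Uᘁ)) ⊗≫ 𝟙 _ := by
            rw [naturality, unit]; monoidal
        _ = _ := by
            rw [ExactPairing.evaluation_coevaluation'']; monoidal }

/-- In a rigid category an oplax half-braiding is the inverse of a half-braiding. -/
def HalfBraiding.ofOplax [RightRigidCategory C] (τ : ∀ U, U ⊗ X ⟶ X ⊗ U)
    (unit : τ (𝟙_ C) = (λ_ X).hom ≫ (ρ_ X).inv)
    (monoidal : ∀ U V, τ (U ⊗ V) =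
      (α_ U V X).hom ≫ U ◁ τ V ≫ (α_ U X V).inv ≫ τ U ▷ V ≫ (α_ X U V).hom)
    (naturality : ∀ {U V} (f : U ⟶ V), f ▷ X ≫ τ V = τ U ≫ X ◁ f) : HalfBraiding X where
  β := oplaxHalfBraidingIso τ unit monoidal naturality
  monoidal U V := by
    set β := oplaxHalfBraidingIso τ unit monoidal naturality
    -- The hexagon is an equality of isomorphisms, so it may be checked on inverses, where it is the
    -- oplax hexagon of `τ`.
    have h : β (U ⊗ V) = (α_ X U V).symm ≪≫ whiskerRightIso (β U) V ≪≫ α_ U X V ≪≫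
        whiskerLeftIso U (β V) ≪≫ (α_ U V X).symm := by
      apply Iso.ext_inv
      change τ (U ⊗ V) = _
      simp only [monoidal, Iso.trans_inv, Iso.symm_inv, whiskerLeftIso_inv, whiskerRightIso_inv,
        Category.assoc]
      rfl
    rw [h]
    simp
  naturality {U V} f := by
    rw [← Iso.eq_comp_inv, Category.assoc, ← Iso.inv_comp_eq]
    exact (naturality f).symm

lemma HalfBraiding.ext_hom {b b' : HalfBraiding X} (h : ∀ U, (b.β U).hom = (b'.β U).hom) :
    b = b' := by
  obtain ⟨β, _, _⟩ := b
  obtain ⟨β', _, _⟩ := b'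
  obtain rfl : β = β' := funext fun U => Iso.ext (h U)
  rfl

end LaxHalfBraiding

/-! ### Duality for the action on a module category -/

section ActionDuality

variable {C : Type u₁} [Category.{v₁} C] [MonoidalCategory C]
  {M : Type u₂} [Category.{v₂} M] [MonoidalLeftAction C M] (Y Y' : C) [ExactPairing Y Y']

lemma actionHomEquiv_symm_comp {m m' m'' : M} (u : m ⟶ Y ⊙ₗ m') (h : m' ⟶ m'') :
    (actionHomEquiv Y Y' m m'').symm (u ≫ Y ⊴ₗ h) = (actionHomEquiv Y Y' m m').symm u ≫ h := by
  apply (actionHomEquiv Y Y' m m'').injective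
  rw [Equiv.apply_symm_apply]
  obtain ⟨v, rfl⟩ := (actionHomEquiv Y Y' m m').surjective u
  rw [Equiv.symm_apply_apply]
  simp [actionHomEquiv]

lemma actionHomEquiv_symm_whiskerLeft_comp {m m' m'' : M} (h : m ⟶ m') (u : m' ⟶ Y ⊙ₗ m'') :
    (actionHomEquiv Y Y' m m'').symm (h ≫ u) = Y' ⊴ₗ h ≫ (actionHomEquiv Y Y' m' m'').symm u := by
  simp [actionHomEquiv]

lemma leftUnitor_inv_actionHom (x : C) (n : M) :
    (λ_ x).inv ⊵ₗ n ≫ (αₗ (𝟙_ C) x n).hom = (λₗ[C] (x ⊙ₗ n)).inv := by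
  have h : (λ_ x).inv ⊵ₗ n = (λₗ[C] _).inv ≫ (αₗ (𝟙_ C) x n).inv := by
    rw [← cancel_mono ((λ_ x).hom ⊵ₗ n), inv_hom_actionHomLeft, leftUnitor_actionHom]
    simp
  rw [h, Category.assoc, Iso.inv_hom_id, Category.comp_id]

lemma associator_actionHom' (x y z : C) (n : M) :
    (αₗ (x ⊗ y) z n).inv ≫ (α_ x y z).hom ⊵ₗ n ≫ (αₗ x (y ⊗ z) n).hom =
      (αₗ x y (z ⊙ₗ n)).hom ≫ x ⊴ₗ (αₗ y z n).inv := by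
  rw [← cancel_mono (x ⊴ₗ (αₗ y z n).hom)]
  simp only [Category.assoc, associator_actionHom, Iso.inv_hom_id_assoc, actionHomRight_inv_hom,
    Category.comp_id]

/-- Compatibility of the duality bijections for `C` and for a module category. -/
lemma tensorLeftHomEquiv_action {x e : C} {n n' : M} (f : Y' ⊗ x ⟶ e) (u : e ⊙ₗ n ⟶ n') :
    tensorLeftHomEquiv x Y Y' e f ⊵ₗ n ≫ (αₗ Y e n).hom ≫ Y ⊴ₗ u =
      actionHomEquiv Y Y' (x ⊙ₗ n) n' ((αₗ Y' x n).inv ≫ f ⊵ₗ n ≫ u) := by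
  simp only [tensorLeftHomEquiv, actionHomEquiv, Equiv.coe_fn_mk, comp_actionHomLeft,
    whiskerLeft_actionHomLeft, whiskerRight_actionHomLeft, Category.assoc, Iso.inv_hom_id_assoc,
    actionHomRight_comp]
  rw [reassoc_of% (leftUnitor_inv_actionHom x n), reassoc_of% (associator_actionHom' Y Y' x n)]

end ActionDuality

/-! ### Universal families `g.F(m) ⟶ G(m)` and their half-braiding -/

section UniversalEv

open Functor.LaxLeftLinear Functor.OplaxLeftLinear Functor.LeftLinear

variable {C : Type u₁} [Category.{v₁} C] [MonoidalCategory C]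
  {M : Type u₂} [Category.{v₂} M]
  {N : Type u₃} [Category.{v₃} N] [MonoidalLeftAction C N]

/-- A natural family `ε m : g.F(m) ⟶ G(m)` such that every natural family `x.F(m) ⟶ G(m)` factors
uniquely through it. -/
structure IsUniversalEv (F G : M ⥤ N) {g : C} (ε : ∀ m, g ⊙ₗ F.obj m ⟶ G.obj m) : Prop where
  naturality {m m' : M} (f : m ⟶ m') : g ⊴ₗ F.map f ≫ ε m' = ε m ≫ G.map f
  existsUnique (x : C) (ν : ∀ m, x ⊙ₗ F.obj m ⟶ G.obj m)
    (hν : ∀ {m m' : M} (f : m ⟶ m'), x ⊴ₗ F.map f ≫ ν m' = ν m ≫ G.map f) :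
    ∃! f : x ⟶ g, ∀ m, f ⊵ₗ F.obj m ≫ ε m = ν m

namespace IsUniversalEv

variable {F G : M ⥤ N} {g : C} {ε : ∀ m, g ⊙ₗ F.obj m ⟶ G.obj m} (hε : IsUniversalEv F G ε)

include hε

lemma naturality_whiskerRight {x : C} (f : x ⟶ g) {m m' : M} (h : m ⟶ m') :
    x ⊴ₗ F.map h ≫ f ⊵ₗ F.obj m' ≫ ε m' = (f ⊵ₗ F.obj m ≫ ε m) ≫ G.map h := by
  rw [action_exchange_assoc, hε.naturality, Category.assoc]

lemma hom_ext {x : C} {f f' : x ⟶ g}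
    (h : ∀ m, f ⊵ₗ F.obj m ≫ ε m = f' ⊵ₗ F.obj m ≫ ε m) : f = f' :=
  (hε.existsUnique x (fun m => f' ⊵ₗ F.obj m ≫ ε m) (hε.naturality_whiskerRight f')).unique h
    fun _ => rfl

variable [RightRigidCategory C]

/-- By duality `Hom(x, c ⊗ g) ≃ Hom(cᘁ ⊗ x, g)`, so `c ⊗ g` inherits the universal property, now for
families `x.F(m) ⟶ c.G(m)`. This is the uniqueness half; `exists_hom_tensor` is the existence half.
-/
lemma hom_tensor_ext {x c : C} {f f' : x ⟶ c ⊗ g}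
    (h : ∀ m, f ⊵ₗ F.obj m ≫ (αₗ c g _).hom ≫ c ⊴ₗ ε m =
      f' ⊵ₗ F.obj m ≫ (αₗ c g _).hom ≫ c ⊴ₗ ε m) : f = f' := by
  obtain ⟨f, rfl⟩ := (tensorLeftHomEquiv x c cᘁ g).surjective f
  obtain ⟨f', rfl⟩ := (tensorLeftHomEquiv x c cᘁ g).surjective f'
  congr 1
  refine hε.hom_ext fun m => ?_
  have := h m
  rw [tensorLeftHomEquiv_action, tensorLeftHomEquiv_action] at this
  simpa only [EmbeddingLike.apply_eq_iff_eq, cancel_epi] using this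

lemma exists_hom_tensor {x c : C} (ν : ∀ m, x ⊙ₗ F.obj m ⟶ c ⊙ₗ G.obj m)
    (hν : ∀ {m m' : M} (f : m ⟶ m'), x ⊴ₗ F.map f ≫ ν m' = ν m ≫ c ⊴ₗ G.map f) :
    ∃ f : x ⟶ c ⊗ g, ∀ m, f ⊵ₗ F.obj m ≫ (αₗ c g _).hom ≫ c ⊴ₗ ε m = ν m := by
  obtain ⟨f, hf, -⟩ := hε.existsUnique (cᘁ ⊗ x)
    (fun m => (αₗ cᘁ x _).hom ≫ (actionHomEquiv c cᘁ _ _).symm (ν m)) (fun {m m'} f => by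
      rw [tensor_actionHomRight, Category.assoc, Category.assoc, Category.assoc,
        Iso.inv_hom_id_assoc, ← actionHomEquiv_symm_whiskerLeft_comp, hν,
        actionHomEquiv_symm_comp])
  refine ⟨tensorLeftHomEquiv x c cᘁ g f, fun m => ?_⟩
  rw [tensorLeftHomEquiv_action, hf, Iso.inv_hom_id_assoc, Equiv.apply_symm_apply]

end IsUniversalEv

section HalfBraiding

variable [MonoidalLeftAction C M] {F G : M ⥤ N} [F.LeftLinear C] [G.LeftLinear C]

/-- A family `x.F(m) ⟶ G(m)` is compatible with the module functor structures of `(x, b).F`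
and `G`. -/
def IsModuleNat (F G : M ⥤ N) [F.LeftLinear C] [G.LeftLinear C] {x : C} (b : HalfBraiding x)
    (ν : ∀ m, x ⊙ₗ F.obj m ⟶ G.obj m) : Prop :=
  ∀ c m, ν (c ⊙ₗ m) ≫ δₗ G c m = (actIso b F c m).hom ≫ c ⊴ₗ ν m

/-- The family `(x ⊗ c).F(m) ≅ x.F(c.m) ⟶ G(c.m) ≅ c.G(m)` induced by a family
`x.F(m) ⟶ G(m)`. -/
def shiftedFamily {x : C} (ν : ∀ m, x ⊙ₗ F.obj m ⟶ G.obj m) (c : C) (m : M) :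
    (x ⊗ c) ⊙ₗ F.obj m ⟶ c ⊙ₗ G.obj m :=
  (αₗ x c (F.obj m)).hom ≫ x ⊴ₗ μₗ F c m ≫ ν (c ⊙ₗ m) ≫ δₗ G c m

/-- Moving the invertible constraint of `F` to the other side isolates `b.β c`. In this form the
condition prescribes the family of `b.β c`, and hence `b.β c` itself when `ν` is universal. -/
lemma isModuleNat_iff {x : C} (b : HalfBraiding x) (ν : ∀ m, x ⊙ₗ F.obj m ⟶ G.obj m) :
    IsModuleNat F G b ν ↔ ∀ c m,
      (b.β c).hom ⊵ₗ F.obj m ≫ (αₗ c x _).hom ≫ c ⊴ₗ ν m = shiftedFamily ν c m := by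
  refine forall₂_congr fun c m => ?_
  rw [← cancel_epi (x ⊴ₗ μₗ F c m), ← cancel_epi (αₗ x c (F.obj m)).hom, eq_comm]
  simp only [shiftedFamily, actIso_hom, Category.assoc, ← actionHomRight_comp_assoc, μₗ_comp_δₗ,
    actionHomRight_id, Category.id_comp, Iso.hom_inv_id_assoc]

section

variable {x : C} {ν : ∀ m, x ⊙ₗ F.obj m ⟶ G.obj m}

lemma shiftedFamily_naturality
    (hν : ∀ {m m' : M} (f : m ⟶ m'), x ⊴ₗ F.map f ≫ ν m' = ν m ≫ G.map f)
    (c : C) {m m' : M} (f : m ⟶ m') :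
    (x ⊗ c) ⊴ₗ F.map f ≫ shiftedFamily ν c m' = shiftedFamily ν c m ≫ c ⊴ₗ G.map f := by
  simp only [shiftedFamily, tensor_actionHomRight, Category.assoc, Iso.inv_hom_id_assoc,
    ← δₗ_naturality_right, ← reassoc_of% hν, ← actionHomRight_comp_assoc, μₗ_naturality_right]

lemma shiftedFamily_naturality_left
    (hν : ∀ {m m' : M} (f : m ⟶ m'), x ⊴ₗ F.map f ≫ ν m' = ν m ≫ G.map f)
    {c c' : C} (f : c ⟶ c') (m : M) :
    (x ◁ f) ⊵ₗ F.obj m ≫ shiftedFamily ν c' m = shiftedFamily ν c m ≫ f ⊵ₗ G.obj m := by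
  simp only [shiftedFamily, whiskerLeft_actionHomLeft, Category.assoc, Iso.inv_hom_id_assoc,
    ← δₗ_naturality_left, ← reassoc_of% hν, ← actionHomRight_comp_assoc, μₗ_naturality_left]

lemma shiftedFamily_unit
    (hν : ∀ {m m' : M} (f : m ⟶ m'), x ⊴ₗ F.map f ≫ ν m' = ν m ≫ G.map f) (m : M) :
    shiftedFamily ν (𝟙_ C) m =
      ((ρ_ x).hom ≫ (λ_ x).inv) ⊵ₗ F.obj m ≫ (αₗ (𝟙_ C) x _).hom ≫ 𝟙_ C ⊴ₗ ν m := by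
  rw [comp_actionHomLeft, Category.assoc, reassoc_of% (leftUnitor_inv_actionHom x (F.obj m)),
    actionUnitIso_inv_naturality, δₗ_unitality_inv, ← reassoc_of% hν, rightUnitor_actionHom,
    μₗ_unitality]
  simp only [shiftedFamily, Category.assoc, ← actionHomRight_comp_assoc, ← F.map_comp,
    Iso.hom_inv_id, F.map_id, Category.comp_id]

/-- This is the associativity of the constraints of `F` and `G`. It becomes the hexagon of the
half-braiding, just as `shiftedFamily_unit` becomes its unit law. -/
lemma shiftedFamily_tensor
    (hν : ∀ {m m' : M} (f : m ⟶ m'), x ⊴ₗ F.map f ≫ ν m' = ν m ≫ G.map f) (c c' : C) (m : M) :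
    shiftedFamily ν (c ⊗ c') m ≫ (αₗ c c' (G.obj m)).hom =
      (α_ x c c').inv ⊵ₗ F.obj m ≫ (αₗ (x ⊗ c) c' (F.obj m)).hom ≫ (x ⊗ c) ⊴ₗ μₗ F c' m ≫
        shiftedFamily ν c (c' ⊙ₗ m) ≫ c ⊴ₗ δₗ G c' m := by
  have p : (α_ x c c').inv ⊵ₗ F.obj m ≫ (αₗ (x ⊗ c) c' (F.obj m)).hom ≫ (αₗ x c _).hom =
      (αₗ x (c ⊗ c') (F.obj m)).hom ≫ x ⊴ₗ (αₗ c c' (F.obj m)).hom := by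
    rw [← associator_actionHom, inv_hom_actionHomLeft_assoc]
  simp only [shiftedFamily, Category.assoc, δₗ_associativity, ← reassoc_of% hν,
    ← actionHomRight_comp_assoc, μₗ_associativity, tensor_actionHomRight, Iso.inv_hom_id_assoc]
  rw [reassoc_of% p]
  simp only [actionHomRight_comp, Category.assoc]

end

namespace IsUniversalEv

variable {g : C} {ε : ∀ m, g ⊙ₗ F.obj m ⟶ G.obj m} (hε : IsUniversalEv F G ε)

include hε

variable [RigidCategory C]

/-- The object of a universal family of morphisms `g.F(m) ⟶ G(m)` between module functors has a
unique half-braiding for which the family is compatible with the module structures. -/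
theorem existsUnique_halfBraiding : ∃! b : HalfBraiding g, IsModuleNat F G b ε := by
  -- By `isModuleNat_iff` this choice of `β c` is the only possible one. Each axiom below compares
  -- two morphisms into some `c ⊗ g` through their families.
  choose β hβ using fun c => hε.exists_hom_tensor (shiftedFamily ε c)
    (shiftedFamily_naturality hε.naturality c)
  refine ⟨HalfBraiding.ofLax β ?_ ?_ ?_, (isModuleNat_iff _ _).2 hβ, fun b hb => ?_⟩
  · exact hε.hom_tensor_ext fun m => by rw [hβ, shiftedFamily_unit hε.naturality]
  · intro c c'
    refine hε.hom_tensor_ext fun m => ?_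
    have p : (α_ c c' g).inv ⊵ₗ F.obj m ≫ (αₗ (c ⊗ c') g (F.obj m)).hom ≫ (αₗ c c' _).hom =
      (αₗ c (c' ⊗ g) (F.obj m)).hom ≫ c ⊴ₗ (αₗ c' g (F.obj m)).hom := by
      rw [← associator_actionHom, inv_hom_actionHomLeft_assoc]
    rw [hβ, ← cancel_mono (αₗ c c' (G.obj m)).hom, shiftedFamily_tensor hε.naturality, ← hβ c]
    simp only [comp_actionHomLeft, tensor_actionHomRight, Category.assoc, Iso.inv_hom_id,
      Category.comp_id]
    rw [reassoc_of% p]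
    have q : (αₗ (c ⊗ g) c' (F.obj m)).inv ≫ (α_ c g c').hom ⊵ₗ F.obj m ≫
        (αₗ c (g ⊗ c') (F.obj m)).hom ≫ c ⊴ₗ (αₗ g c' (F.obj m)).hom = (αₗ c g _).hom := by
      rw [associator_actionHom, Iso.inv_hom_id_assoc]
    have h := congrArg (fun t => c ⊴ₗ t) (hβ c' m)
    simp only [shiftedFamily, actionHomRight_comp] at h
    rw [whiskerLeft_actionHomLeft_assoc, whiskerRight_actionHomLeft, Category.assoc,
      Category.assoc, Iso.inv_hom_id_assoc, h, reassoc_of% q]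
    -- Interchange slides the constraint of `F` at `c'` past `β c`, bringing the two sides of the
    -- hexagon to the same form.
    have r := action_exchange (β c) (μₗ F c' m)
    simp only [tensor_actionHomRight, Category.assoc] at r
    rw [reassoc_of% r, Iso.inv_hom_id_assoc]
  · intro c c' f
    refine hε.hom_tensor_ext fun m => ?_
    rw [comp_actionHomLeft, Category.assoc, hβ, shiftedFamily_naturality_left hε.naturality, ← hβ]
    simp only [comp_actionHomLeft, whiskerRight_actionHomLeft, Category.assoc,
      Iso.inv_hom_id_assoc, action_exchange]
  · refine HalfBraiding.ext_hom fun c => hε.hom_tensor_ext fun m => ?_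
    rw [(isModuleNat_iff _ _).1 hb]
    exact (hβ c m).symm

/-- A universal family is also universal in the Drinfeld center. -/
lemma isModuleNat_comp_iff {b : HalfBraiding g} (hb : IsModuleNat F G b ε) {x : C}
    (b' : HalfBraiding x) (f : x ⟶ g) :
    IsModuleNat F G b' (fun m => f ⊵ₗ F.obj m ≫ ε m) ↔
      ∀ c, f ▷ c ≫ (b.β c).hom = (b'.β c).hom ≫ c ◁ f := by
  have h (c : C) (m : M) : (f ▷ c) ⊵ₗ F.obj m ≫ shiftedFamily ε c m =
      shiftedFamily (fun m => f ⊵ₗ F.obj m ≫ ε m) c m := by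
    simp only [shiftedFamily, whiskerRight_actionHomLeft, Category.assoc, Iso.inv_hom_id_assoc,
      action_exchange_assoc]
  rw [isModuleNat_iff] at hb ⊢
  -- Both sides of the compatibility square are morphisms `x ⊗ c ⟶ c ⊗ g`, hence determined by their
  -- families `(x ⊗ c).F(m) ⟶ c.G(m)`.
  refine forall_congr' fun c => ⟨fun h' => hε.hom_tensor_ext fun m => ?_, fun h' m => ?_⟩
  · rw [comp_actionHomLeft, Category.assoc, hb, h, ← h']
    simp
  · rw [← h, ← hb, ← comp_actionHomLeft_assoc, h']
    simp

end IsUniversalEv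

end HalfBraiding

end UniversalEv

/-! ### Ends of internal Homs and central integration -/

namespace InternalHom

variable {C : Type u₁} [Category.{v₁} C] [MonoidalCategory C]
  {N : Type u₃} [Category.{v₃} N] [MonoidalLeftAction C N] (H : InternalHom C N)

lemma homEquiv_symm_comp_map {c : C} {m m' m'' : N} (p : c ⟶ H.ihom m m') (h : m' ⟶ m'') :
    (H.homEquiv c m m'').symm (p ≫ (H.hom.obj (op m)).map h) = (H.homEquiv c m m').symm p ≫ h :=
  H.adj.homEquiv_symm_naturality_three h p

lemma homEquiv_symm_comp_map_op {c : C} {n m m' : N} (f : n ⟶ m) (p : c ⟶ H.ihom m m') :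
    (H.homEquiv c n m').symm (p ≫ (H.hom.map f.op).app m') =
      c ⊴ₗ f ≫ (H.homEquiv c m m').symm p :=
  H.adj.homEquiv_symm_naturality_one f p

section

variable [RigidCategory C]

/-- The isomorphism is defined by the image of the identity under a natural bijection; naturality
gives its effect on an arbitrary `p`. This avoids unfolding it later. -/
lemma comp_rightModuleIso_hom {c γ : C} {m m' : N} (p : γ ⟶ H.ihom (c ⊙ₗ m) m') :
    p ≫ (H.rightModuleIso c m m').hom =
      tensorRightHomEquiv γ c cᘁ _
        (H.homEquiv (γ ⊗ c) m m' ((αₗ γ c m).hom ≫ (H.homEquiv γ (c ⊙ₗ m) m').symm p)) := by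
  rw [rightModuleIso, isoOfHomToEquiv_hom]
  apply (tensorRightHomEquiv γ c cᘁ (H.ihom m m')).symm.injective
  rw [tensorRightHomEquiv_symm_naturality]
  simp [← homEquiv_naturality, H.homEquiv_symm_eq p]

lemma comp_leftModuleIso_hom {c γ : C} {m m' : N} (p : γ ⟶ H.ihom m (c ⊙ₗ m')) :
    p ≫ (H.leftModuleIso c m m').hom =
      tensorLeftHomEquiv γ c cᘁ _ (H.homEquiv (cᘁ ⊗ γ) m m' ((αₗ cᘁ γ m).hom ≫
        (actionHomEquiv c cᘁ _ _).symm ((H.homEquiv γ m (c ⊙ₗ m')).symm p))) := by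
  rw [leftModuleIso, isoOfHomToEquiv_hom]
  apply (tensorLeftHomEquiv γ c cᘁ (H.ihom m m')).symm.injective
  rw [tensorLeftHomEquiv_symm_naturality]
  simp [← homEquiv_naturality, H.homEquiv_symm_eq p, actionHomEquiv_symm_whiskerLeft_comp]

lemma tensor_hom_injective {x c : C} {n n' : N} {p p' : x ⟶ c ⊗ H.ihom n n'} :
    p = p' ↔ p ⊵ₗ n ≫ (αₗ c _ n).hom ≫ c ⊴ₗ H.ev n n' =
      p' ⊵ₗ n ≫ (αₗ c _ n).hom ≫ c ⊴ₗ H.ev n n' := by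
  obtain ⟨p, rfl⟩ := (tensorLeftHomEquiv x c cᘁ _).surjective p
  obtain ⟨p', rfl⟩ := (tensorLeftHomEquiv x c cᘁ _).surjective p'
  simp only [tensorLeftHomEquiv_action, EmbeddingLike.apply_eq_iff_eq, cancel_epi,
    ← homEquiv_symm_eq]

end

open Functor.LaxLeftLinear Functor.OplaxLeftLinear Functor.LeftLinear

variable {M : Type u₂} [Category.{v₂} M]

/-- Transposition identifies wedges with vertex `x` and natural families `x.F(m) ⟶ G(m)`, so the end
and the universal family are the same datum. -/
lemma wedge_condition_iff {F G : M ⥤ N} {x : C} (p : ∀ m, x ⟶ H.ihom (F.obj m) (G.obj m))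
    {m m' : M} (f : m ⟶ m') :
    p m ≫ ((H.pullback F G).obj (op m)).map f = p m' ≫ ((H.pullback F G).map f.op).app m' ↔
      x ⊴ₗ F.map f ≫ (H.homEquiv _ _ _).symm (p m') = (H.homEquiv _ _ _).symm (p m) ≫ G.map f := by
  rw [← H.homEquiv_symm_comp_map, ← H.homEquiv_symm_comp_map_op, EmbeddingLike.apply_eq_iff_eq,
    eq_comm]
  rfl

lemma hasEnd_of_isUniversalEv {F G : M ⥤ N} {g : C} {ε : ∀ m, g ⊙ₗ F.obj m ⟶ G.obj m}
    (hε : IsUniversalEv F G ε) : HasEnd (H.pullback F G) := by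
  let W : Wedge (H.pullback F G) := Wedge.mk g (fun m => H.homEquiv _ _ _ (ε m)) (fun m m' f =>
    (H.wedge_condition_iff (fun m => H.homEquiv _ _ _ (ε m)) f).2 (by simpa using hε.naturality f))
  choose l hl using fun s : Wedge (H.pullback F G) => (hε.existsUnique s.pt
    (fun m => (H.homEquiv _ _ _).symm (s.ι m)) (fun f => (H.wedge_condition_iff _ f).1
      (s.condition f))).exists
  have hι {x : C} (f : x ⟶ g) (m : M) (p : x ⟶ H.ihom (F.obj m) (G.obj m)) :
      f ≫ H.homEquiv _ _ _ (ε m) = p ↔ f ⊵ₗ F.obj m ≫ ε m = (H.homEquiv _ _ _).symm p := by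
    rw [← H.homEquiv_naturality, Equiv.eq_symm_apply]
  exact ⟨⟨W, Multifork.IsLimit.mk W l (fun s m => (hι _ m _).2 (hl s m)) (fun s f hf =>
    hε.hom_ext fun m => ((hι _ m _).1 (hf m)).trans (hl s m).symm)⟩⟩

lemma isUniversalEv_end {F G : M ⥤ N} [HasEnd (H.pullback F G)] :
    IsUniversalEv F G fun m => (H.homEquiv _ (F.obj m) (G.obj m)).symm
      (end_.π (H.pullback F G) m) where
  naturality f := (H.wedge_condition_iff _ f).1 (end_.condition _ f)
  existsUnique x ν hν := by
    refine ⟨end_.lift (F := H.pullback F G) (fun m => H.homEquiv _ _ _ (ν m)) (fun m m' f =>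
      (H.wedge_condition_iff (fun m => H.homEquiv _ _ _ (ν m)) f).2 (by simpa using hν f)),
      fun m => ?_, fun f hf => ?_⟩
    · rw [← H.homEquiv_symm_naturality, end_.lift_π, Equiv.symm_apply_apply]
    · refine end_.hom_ext fun m => ?_
      rw [end_.lift_π, ← hf m, H.homEquiv_naturality, Equiv.apply_symm_apply]

variable [MonoidalLeftAction C M] [RigidCategory C]

/-- Under the two dualities moving `c` and `cᘁ` across, the right-hand side of the central
integration equation is the shifted family. -/
lemma comp_pullbackBimoduleIso_hom {F G : M ⥤ N} [F.LeftLinear C] [G.LeftLinear C] {x : C}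
    (j : ∀ m, x ⟶ H.ihom (F.obj m) (G.obj m)) (c : C) (m : M) :
    j (c ⊙ₗ m) ≫ (H.pullbackBimoduleIso F G c c m m).hom =
      tensorRightHomEquiv x c cᘁ (c ⊗ H.ihom (F.obj m) (G.obj m))
        (tensorLeftHomEquiv _ c cᘁ _ (H.homEquiv _ _ _ ((αₗ cᘁ (x ⊗ c) (F.obj m)).hom ≫
          (actionHomEquiv c cᘁ _ _).symm
            (shiftedFamily (fun m => (H.homEquiv _ (F.obj m) (G.obj m)).symm (j m)) c m)))) := by
  change j (c ⊙ₗ m) ≫ (H.hom.map (μₗ F c m).op).app (G.obj (c ⊙ₗ m)) ≫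
    (H.hom.obj (op (c ⊙ₗ F.obj m))).map (δₗ G c m) ≫ (H.rightModuleIso c (F.obj m) _).hom ≫
      (H.leftModuleIso c (F.obj m) (G.obj m)).hom ▷ cᘁ = _
  rw [← Category.assoc, ← Category.assoc, ← Category.assoc, comp_rightModuleIso_hom,
    ← tensorRightHomEquiv_naturality, comp_leftModuleIso_hom, Equiv.symm_apply_apply,
    homEquiv_symm_comp_map, homEquiv_symm_comp_map_op, Category.assoc]
  rfl

/-- Both sides are transposed along `cᘁ` and then tested against the evaluation of the internal Hom,
which yields the equation of `isModuleNat_iff`. -/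
lemma isCentralEnd_iff {F G : M ⥤ N} [F.LeftLinear C] [G.LeftLinear C] {g : C}
    (j : ∀ m, g ⟶ H.ihom (F.obj m) (G.obj m)) (b : HalfBraiding g) :
    IsCentralEnd (H.pullbackBimoduleIso F G) j b ↔
      IsModuleNat F G b fun m => (H.homEquiv _ _ _).symm (j m) := by
  rw [isModuleNat_iff]
  refine forall₂_congr fun c m => ?_
  rw [comp_pullbackBimoduleIso_hom, centralCoaction]
  refine (Eq.congr_left (tensorRightHomEquiv_naturality _ _).symm).trans ?_
  refine (Equiv.apply_eq_iff_eq _).trans ?_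
  refine (H.tensor_hom_injective (p := (b.β c).hom ≫ c ◁ j m)).trans ?_
  rw [tensorLeftHomEquiv_action, ← homEquiv_symm_eq, Equiv.symm_apply_apply,
    Iso.inv_hom_id_assoc, Equiv.apply_symm_apply, homEquiv_symm_eq]
  simp

end InternalHom

/-! ### Internal coHoms and universal families `G(m) ⟶ h.F(m)` -/

namespace InternalCohom

variable {C : Type u₁} [Category.{v₁} C] [MonoidalCategory C]
  {N : Type u₃} [Category.{v₃} N] [MonoidalLeftAction C N] (H : InternalCohom C N)

lemma homEquiv_map_comp {c : C} {m' m n : N} (h : m ⟶ n) (p : H.icohom m' n ⟶ c) :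
    H.homEquiv m' m c ((H.cohom.obj (op m')).map h ≫ p) = h ≫ H.homEquiv m' n c p :=
  H.adj.homEquiv_naturality_two (X₁ := op m') h p

lemma homEquiv_map_op_comp {c : C} {m' n' m : N} (f : n' ⟶ m') (p : H.icohom n' m ⟶ c) :
    H.homEquiv m' m c ((H.cohom.map f.op).app m ≫ p) = H.homEquiv n' m c p ≫ c ⊴ₗ f :=
  H.adj.homEquiv_naturality_one f.op p

end InternalCohom

section UniversalCoev

variable {C : Type u₁} [Category.{v₁} C] [MonoidalCategory C]
  {M : Type u₂} [Category.{v₂} M]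
  {N : Type u₃} [Category.{v₃} N] [MonoidalLeftAction C N]

/-- A natural family `η m : G(m) ⟶ h.F(m)` such that every natural family `G(m) ⟶ x.F(m)` factors
uniquely through it. -/
structure IsUniversalCoev (F G : M ⥤ N) {h : C} (η : ∀ m, G.obj m ⟶ h ⊙ₗ F.obj m) : Prop where
  naturality {m m' : M} (f : m ⟶ m') : G.map f ≫ η m' = η m ≫ h ⊴ₗ F.map f
  existsUnique (x : C) (ν : ∀ m, G.obj m ⟶ x ⊙ₗ F.obj m)
    (hν : ∀ {m m' : M} (f : m ⟶ m'), G.map f ≫ ν m' = ν m ≫ x ⊴ₗ F.map f) :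
    ∃! f : h ⟶ x, ∀ m, η m ≫ f ⊵ₗ F.obj m = ν m

end UniversalCoev

/-! ### Existence of the universal families -/

section Existence

attribute [local instance] Abelian.hasFiniteBiproducts

/-- Commutation with an endomorphism is a linear condition on it. Reducing to a finite spanning set
lets a kernel or cokernel involving a finite direct sum encode the whole condition. -/
lemma Functor.map_comp_eq_of_span {k : Type w} [Field k] {D : Type u₁} [Category.{v₁} D]
    [Preadditive D] [Linear k D] {E : Type u₂} [Category.{v₂} E] [Preadditive E] [Linear k E]
    {F G : D ⥤ E} [F.Additive] [F.Linear k] [G.Additive] [G.Linear k] {P : D} {n : ℕ}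
    {s : Fin n → (P ⟶ P)} (hs : Submodule.span k (Set.range s) = ⊤) {h : F.obj P ⟶ G.obj P}
    (hh : ∀ i, F.map (s i) ≫ h = h ≫ G.map (s i)) (a : P ⟶ P) : F.map a ≫ h = h ≫ G.map a := by
  obtain ⟨c, rfl⟩ := (Submodule.mem_span_range_iff_exists_fun k).1
    (hs ▸ Submodule.mem_top : a ∈ Submodule.span k (Set.range s))
  simp only [F.map_sum, G.map_sum, F.map_smul, G.map_smul, Preadditive.sum_comp,
    Preadditive.comp_sum, Linear.smul_comp, Linear.comp_smul, hh]

variable {k : Type w} [Field k]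
    {C : Type u₁} [Category.{v₁} C] [Abelian C] [Linear k C] [MonoidalCategory C]
    {M : Type u₂} [Category.{v₂} M] [Abelian M] [Linear k M]
    {N : Type u₃} [Category.{v₃} N] [Abelian N] [Linear k N] [MonoidalLeftAction C N]
    [IsFiniteModuleCategory k C N]
    {P : M} (hP : IsFiniteProgenerator k P) (F G : M ⥤ N) [F.Additive] [F.Linear k] [G.Additive]
    [G.Linear k]

include hP

/-- Since `x.F` is right exact, a natural family is its component at `P`, that is, a morphism `x ⟶
ihom(F P, G P)` equalizing the two actions of `End(P)`. The kernel of their differences represents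
these. -/
theorem InternalHom.exists_isUniversalEv [PreservesFiniteColimits F] (H : InternalHom C N) :
    ∃ (g : C) (ε : ∀ m, g ⊙ₗ F.obj m ⟶ G.obj m), IsUniversalEv F G ε := by
  have (c : C) : (actionLeft N c).Additive := IsFiniteModuleCategory.additive_actionLeft k c
  have (c : C) : (actionLeft N c).Linear k := IsFiniteModuleCategory.linear_actionLeft c
  have (c : C) : PreservesFiniteColimits (actionLeft N c) :=
    IsFiniteModuleCategory.rightExact_actionLeft k c
  have (c : C) : PreservesFiniteColimits (F ⋙ actionLeft N c) := comp_preservesFiniteColimits _ _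
  have := hP.finite_hom P
  obtain ⟨n, s, hs⟩ := Module.Finite.exists_fin (R := k) (M := (P ⟶ P))
  let d (i : Fin n) : H.ihom (F.obj P) (G.obj P) ⟶ H.ihom (F.obj P) (G.obj P) :=
    (H.hom.map (F.map (s i)).op).app _ - (H.hom.obj _).map (G.map (s i))
  have hd {x : C} (p : x ⟶ H.ihom (F.obj P) (G.obj P)) : p ≫ biproduct.lift d = 0 ↔
      ∀ i, x ⊴ₗ F.map (s i) ≫ (H.homEquiv _ _ _).symm p =
        (H.homEquiv _ _ _).symm p ≫ G.map (s i) := by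
    simp_rw [← H.homEquiv_symm_comp_map, ← H.homEquiv_symm_comp_map_op,
      EmbeddingLike.apply_eq_iff_eq]
    constructor
    · intro h i
      have := h =≫ biproduct.π _ i
      rwa [Category.assoc, biproduct.lift_π, zero_comp, Preadditive.comp_sub, sub_eq_zero] at this
    · intro h
      ext i
      rw [Category.assoc, biproduct.lift_π, zero_comp, Preadditive.comp_sub, sub_eq_zero, h]
  let g := kernel (biproduct.lift d)
  let ι : g ⟶ H.ihom (F.obj P) (G.obj P) := kernel.ι _
  obtain ⟨α, hα', hα⟩ : ∃ α : ∀ m, g ⊙ₗ F.obj m ⟶ G.obj m,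
      (∀ {m m' : M} (f : m ⟶ m'), g ⊴ₗ F.map f ≫ α m' = α m ≫ G.map f) ∧
        α P = (H.homEquiv _ _ _).symm ι :=
    let ⟨α, hα⟩ := hP.exists_natTrans (F := F ⋙ actionLeft N g) (G := G)
      ((H.homEquiv _ _ _).symm ι)
      (Functor.map_comp_eq_of_span hs fun i => (hd ι).1 (kernel.condition _) i)
    ⟨α.app, fun f => α.naturality f, hα⟩
  have hε (x : C) (f : x ⟶ g) :
      f ⊵ₗ F.obj P ≫ α P = (H.homEquiv _ _ _).symm (f ≫ ι) := by
    rw [hα, H.homEquiv_symm_naturality]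
  refine ⟨g, α, hα', fun x ν hν => ?_⟩
  let ν' : F ⋙ actionLeft N x ⟶ G := { app := ν, naturality := fun _ _ f => hν f }
  have hl : H.homEquiv _ _ _ (ν P) ≫ biproduct.lift d = 0 :=
    (hd _).2 fun i => by rw [Equiv.symm_apply_apply, hν]
  refine ⟨kernel.lift _ _ hl, fun m => ?_, fun f hf => ?_⟩
  · have hμ {m m' : M} (f : m ⟶ m') : x ⊴ₗ F.map f ≫ kernel.lift _ _ hl ⊵ₗ F.obj m' ≫ α m' =
        (kernel.lift _ _ hl ⊵ₗ F.obj m ≫ α m) ≫ G.map f := by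
      rw [action_exchange_assoc, hα', Category.assoc]
    let μ : F ⋙ actionLeft N x ⟶ G :=
      { app := fun m => kernel.lift _ _ hl ⊵ₗ F.obj m ≫ α m
        naturality := fun m m' f => hμ f }
    -- Two natural transformations out of a right exact functor agree once they agree at `P`, where
    -- this is the kernel factorization.
    have : μ = ν' := hP.natTrans_ext ((hε _ _).trans (by
      rw [kernel.lift_ι, Equiv.symm_apply_apply]))
    exact congr_app this m
  · rw [← cancel_mono ι, kernel.lift_ι]
    apply (H.homEquiv _ _ _).symm.injective
    rw [← hε, Equiv.symm_apply_apply]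
    exact hf P

/-- Now `G` is the source, so its right exactness is what reduces families to `P`, while `x.F` only
has to be additive and linear. The representing object is a cokernel of `icohom(F P, G P)`. -/
theorem InternalCohom.exists_isUniversalCoev [PreservesFiniteColimits G]
    (H : InternalCohom C N) :
    ∃ (h : C) (η : ∀ m, G.obj m ⟶ h ⊙ₗ F.obj m), IsUniversalCoev F G η := by
  have (c : C) : (actionLeft N c).Additive := IsFiniteModuleCategory.additive_actionLeft k c
  have (c : C) : (actionLeft N c).Linear k := IsFiniteModuleCategory.linear_actionLeft c
  have := hP.finite_hom P
  obtain ⟨n, s, hs⟩ := Module.Finite.exists_fin (R := k) (M := (P ⟶ P))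
  let d (i : Fin n) : H.icohom (F.obj P) (G.obj P) ⟶ H.icohom (F.obj P) (G.obj P) :=
    (H.cohom.map (F.map (s i)).op).app _ - (H.cohom.obj _).map (G.map (s i))
  have hd {x : C} (p : H.icohom (F.obj P) (G.obj P) ⟶ x) : biproduct.desc d ≫ p = 0 ↔
      ∀ i, G.map (s i) ≫ H.homEquiv _ _ _ p = H.homEquiv _ _ _ p ≫ x ⊴ₗ F.map (s i) := by
    simp_rw [← H.homEquiv_map_comp, ← H.homEquiv_map_op_comp, EmbeddingLike.apply_eq_iff_eq]
    constructor
    · intro h i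
      have := biproduct.ι _ i ≫= h
      rwa [biproduct.ι_desc_assoc, comp_zero, Preadditive.sub_comp, sub_eq_zero, eq_comm] at this
    · intro h
      ext i
      rw [biproduct.ι_desc_assoc, comp_zero, Preadditive.sub_comp, sub_eq_zero, h]
  let h := cokernel (biproduct.desc d)
  let q : H.icohom (F.obj P) (G.obj P) ⟶ h := cokernel.π _
  obtain ⟨α, hα', hα⟩ : ∃ α : ∀ m, G.obj m ⟶ h ⊙ₗ F.obj m,
      (∀ {m m' : M} (f : m ⟶ m'), G.map f ≫ α m' = α m ≫ h ⊴ₗ F.map f) ∧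
        α P = H.homEquiv _ _ _ q :=
    let ⟨α, hα⟩ := hP.exists_natTrans (F := G) (G := F ⋙ actionLeft N h) (H.homEquiv _ _ _ q)
      (Functor.map_comp_eq_of_span (F := G) (G := F ⋙ actionLeft N h) hs fun i =>
        (hd q).1 (cokernel.condition _) i)
    ⟨α.app, fun f => α.naturality f, hα⟩
  have hη (x : C) (f : h ⟶ x) :
      α P ≫ f ⊵ₗ F.obj P = H.homEquiv _ _ _ (q ≫ f) := by
    rw [hα, H.homEquiv_naturality]
  refine ⟨h, α, hα', fun x ν hν => ?_⟩
  let ν' : G ⟶ F ⋙ actionLeft N x := { app := ν, naturality := fun _ _ f => hν f }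
  have hl : biproduct.desc d ≫ (H.homEquiv _ _ _).symm (ν P) = 0 :=
    (hd _).2 fun i => by rw [Equiv.apply_symm_apply, hν]
  refine ⟨cokernel.desc _ _ hl, fun m => ?_, fun f hf => ?_⟩
  · have hμ {m m' : M} (f : m ⟶ m') : G.map f ≫ α m' ≫ cokernel.desc _ _ hl ⊵ₗ F.obj m' =
        (α m ≫ cokernel.desc _ _ hl ⊵ₗ F.obj m) ≫ x ⊴ₗ F.map f := by
      rw [reassoc_of% hα', Category.assoc, action_exchange]
    let μ : G ⟶ F ⋙ actionLeft N x :=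
      { app := fun m => α m ≫ cokernel.desc _ _ hl ⊵ₗ F.obj m
        naturality := fun m m' f => hμ f }
    have : μ = ν' := hP.natTrans_ext ((hη _ _).trans (by
      rw [cokernel.π_desc, Equiv.apply_symm_apply]))
    exact congr_app this m
  · rw [← cancel_epi q, cokernel.π_desc]
    apply (H.homEquiv _ _ _).injective
    rw [← hη, Equiv.apply_symm_apply]
    exact hf P

end Existence

section ActionDuality

variable {C : Type u₁} [Category.{v₁} C] [MonoidalCategory C]
  {M : Type u₂} [Category.{v₂} M] [MonoidalLeftAction C M] (Y Y' : C) [ExactPairing Y Y']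

lemma actionHomEquiv_whiskerLeft_comp {m m' m'' : M} (h : m ⟶ m') (v : Y' ⊙ₗ m' ⟶ m'') :
    actionHomEquiv Y Y' m m'' (Y' ⊴ₗ h ≫ v) = h ≫ actionHomEquiv Y Y' m' m'' v := by
  apply (actionHomEquiv Y Y' m m'').symm.injective
  rw [Equiv.symm_apply_apply, actionHomEquiv_symm_whiskerLeft_comp, Equiv.symm_apply_apply]

lemma actionHomEquiv_comp {m m' m'' : M} (v : Y' ⊙ₗ m ⟶ m') (h : m' ⟶ m'') :
    actionHomEquiv Y Y' m m'' (v ≫ h) = actionHomEquiv Y Y' m m' v ≫ Y ⊴ₗ h := by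
  apply (actionHomEquiv Y Y' m m'').symm.injective
  rw [Equiv.symm_apply_apply, actionHomEquiv_symm_comp, Equiv.symm_apply_apply]

/-- Compatibility of the duality bijections for `C` and for a module category. -/
lemma comp_tensorLeftHomEquiv_action {x e : C} {n n' : M} (f : Y' ⊗ x ⟶ e) (u : n ⟶ x ⊙ₗ n') :
    u ≫ tensorLeftHomEquiv x Y Y' e f ⊵ₗ n' =
      actionHomEquiv Y Y' n (e ⊙ₗ n') (Y' ⊴ₗ u ≫ (αₗ Y' x n').inv ≫ f ⊵ₗ n') ≫
        (αₗ Y e n').inv := by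
  have h := tensorLeftHomEquiv_action Y Y' f (𝟙 (e ⊙ₗ n'))
  rw [actionHomRight_id, Category.comp_id, Category.comp_id] at h
  rw [actionHomEquiv_whiskerLeft_comp, ← h]
  simp

end ActionDuality

/-! ### The half-braiding on a universal family `G(m) ⟶ h.F(m)` -/

section UniversalCoev

open Functor.LaxLeftLinear Functor.OplaxLeftLinear Functor.LeftLinear

variable {C : Type u₁} [Category.{v₁} C] [MonoidalCategory C]
  {M : Type u₂} [Category.{v₂} M]
  {N : Type u₃} [Category.{v₃} N] [MonoidalLeftAction C N]

namespace IsUniversalCoev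

variable {F G : M ⥤ N} {h : C} {η : ∀ m, G.obj m ⟶ h ⊙ₗ F.obj m} (hη : IsUniversalCoev F G η)

include hη

lemma naturality_whiskerRight {x : C} (f : h ⟶ x) {m m' : M} (u : m ⟶ m') :
    G.map u ≫ η m' ≫ f ⊵ₗ F.obj m' = (η m ≫ f ⊵ₗ F.obj m) ≫ x ⊴ₗ F.map u := by
  rw [reassoc_of% hη.naturality, Category.assoc, action_exchange]

lemma hom_ext {x : C} {f f' : h ⟶ x}
    (e : ∀ m, η m ≫ f ⊵ₗ F.obj m = η m ≫ f' ⊵ₗ F.obj m) : f = f' :=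
  (hη.existsUnique x (fun m => η m ≫ f' ⊵ₗ F.obj m) (hη.naturality_whiskerRight f')).unique e
    fun _ => rfl

variable [LeftRigidCategory C]

/-- Through `Hom(c ⊗ h, x) ≃ Hom(h, ᘁc ⊗ x)`, the object `c ⊗ h` is universal for families `c.G(m) ⟶
x.F(m)`; `exists_tensor_hom` is the existence half. -/
lemma tensor_hom_ext {x c : C} {f f' : c ⊗ h ⟶ x}
    (e : ∀ m, c ⊴ₗ η m ≫ (αₗ c h _).inv ≫ f ⊵ₗ F.obj m =
      c ⊴ₗ η m ≫ (αₗ c h _).inv ≫ f' ⊵ₗ F.obj m) : f = f' := by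
  apply (tensorLeftHomEquiv h (ᘁc : C) c x).injective
  refine hη.hom_ext fun m => ?_
  rw [comp_tensorLeftHomEquiv_action, comp_tensorLeftHomEquiv_action, e]

lemma exists_tensor_hom {x c : C} (ν : ∀ m, c ⊙ₗ G.obj m ⟶ x ⊙ₗ F.obj m)
    (hν : ∀ {m m' : M} (f : m ⟶ m'), c ⊴ₗ G.map f ≫ ν m' = ν m ≫ x ⊴ₗ F.map f) :
    ∃ f : c ⊗ h ⟶ x, ∀ m, c ⊴ₗ η m ≫ (αₗ c h _).inv ≫ f ⊵ₗ F.obj m = ν m := by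
  obtain ⟨f, hf, -⟩ := hη.existsUnique ((ᘁc : C) ⊗ x)
    (fun m => actionHomEquiv (ᘁc : C) c _ _ (ν m) ≫ (αₗ (ᘁc : C) x _).inv) (fun {m m'} f => by
      rw [tensor_actionHomRight, Category.assoc, Iso.inv_hom_id_assoc,
        ← Category.assoc, ← actionHomEquiv_whiskerLeft_comp, hν, actionHomEquiv_comp,
        Category.assoc])
  refine ⟨(tensorLeftHomEquiv h (ᘁc : C) c x).symm f, fun m => ?_⟩
  apply (actionHomEquiv (ᘁc : C) c _ _).injective
  rw [← cancel_mono (αₗ (ᘁc : C) x _).inv, ← comp_tensorLeftHomEquiv_action,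
    Equiv.apply_symm_apply, hf]

end IsUniversalCoev

section HalfBraiding

variable [MonoidalLeftAction C M] {F G : M ⥤ N} [F.LeftLinear C] [G.LeftLinear C]

/-- A family `G(m) ⟶ x.F(m)` is compatible with the module functor structures of `G`
and `(x, b).F`. -/
def IsModuleConat (F G : M ⥤ N) [F.LeftLinear C] [G.LeftLinear C] {x : C} (b : HalfBraiding x)
    (ν : ∀ m, G.obj m ⟶ x ⊙ₗ F.obj m) : Prop :=
  ∀ c m, ν (c ⊙ₗ m) ≫ (actIso b F c m).hom = δₗ G c m ≫ c ⊴ₗ ν m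

/-- The family `c.G(m) ≅ G(c.m) ⟶ x.F(c.m) ≅ (x ⊗ c).F(m)` induced by a family
`G(m) ⟶ x.F(m)`. -/
def coshiftedFamily {x : C} (ν : ∀ m, G.obj m ⟶ x ⊙ₗ F.obj m) (c : C) (m : M) :
    c ⊙ₗ G.obj m ⟶ (x ⊗ c) ⊙ₗ F.obj m :=
  μₗ G c m ≫ ν (c ⊙ₗ m) ≫ x ⊴ₗ δₗ F c m ≫ (αₗ x c (F.obj m)).inv

/-- Universality controls morphisms out of `c ⊗ h`, so the condition is solved for the inverse of
`b.β c`. This is why the dual argument builds an oplax half-braiding. -/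
lemma isModuleConat_iff {x : C} (b : HalfBraiding x) (ν : ∀ m, G.obj m ⟶ x ⊙ₗ F.obj m) :
    IsModuleConat F G b ν ↔ ∀ c m,
      c ⊴ₗ ν m ≫ (αₗ c x _).inv ≫ (b.β c).inv ⊵ₗ F.obj m = coshiftedFamily ν c m := by
  refine forall₂_congr fun c m => ?_
  rw [← cancel_epi (μₗ G c m), ← cancel_mono ((αₗ c x _).inv ≫ (b.β c).inv ⊵ₗ F.obj m), eq_comm]
  simp only [coshiftedFamily, actIso_hom, Category.assoc, μₗ_comp_δₗ_assoc, Iso.hom_inv_id_assoc,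
    hom_inv_actionHomLeft, Category.comp_id]

section

variable {x : C} {ν : ∀ m, G.obj m ⟶ x ⊙ₗ F.obj m}

lemma coshiftedFamily_naturality
    (hν : ∀ {m m' : M} (f : m ⟶ m'), G.map f ≫ ν m' = ν m ≫ x ⊴ₗ F.map f)
    (c : C) {m m' : M} (f : m ⟶ m') :
    c ⊴ₗ G.map f ≫ coshiftedFamily ν c m' = coshiftedFamily ν c m ≫ (x ⊗ c) ⊴ₗ F.map f := by
  simp only [coshiftedFamily, tensor_actionHomRight, Category.assoc, Iso.inv_hom_id_assoc,
    μₗ_naturality_right_assoc, reassoc_of% hν, ← actionHomRight_comp_assoc,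
    δₗ_naturality_right]

lemma coshiftedFamily_naturality_left
    (hν : ∀ {m m' : M} (f : m ⟶ m'), G.map f ≫ ν m' = ν m ≫ x ⊴ₗ F.map f)
    {c c' : C} (f : c ⟶ c') (m : M) :
    f ⊵ₗ G.obj m ≫ coshiftedFamily ν c' m = coshiftedFamily ν c m ≫ (x ◁ f) ⊵ₗ F.obj m := by
  simp only [coshiftedFamily, whiskerLeft_actionHomLeft, Category.assoc, Iso.inv_hom_id_assoc,
    μₗ_naturality_left_assoc, reassoc_of% hν, ← actionHomRight_comp_assoc, δₗ_naturality_left]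

lemma coshiftedFamily_unit
    (hν : ∀ {m m' : M} (f : m ⟶ m'), G.map f ≫ ν m' = ν m ≫ x ⊴ₗ F.map f) (m : M) :
    coshiftedFamily ν (𝟙_ C) m =
      𝟙_ C ⊴ₗ ν m ≫ (αₗ (𝟙_ C) x _).inv ≫ ((λ_ x).hom ≫ (ρ_ x).inv) ⊵ₗ F.obj m := by
  have h₁ : x ⊴ₗ (λₗ[C] (F.obj m)).inv ≫ (αₗ x (𝟙_ C) (F.obj m)).inv = (ρ_ x).inv ⊵ₗ F.obj m := by
    rw [← cancel_mono ((ρ_ x).hom ⊵ₗ F.obj m), inv_hom_actionHomLeft, rightUnitor_actionHom]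
    simp [← actionHomRight_comp]
  rw [comp_actionHomLeft, leftUnitor_actionHom, Category.assoc, Iso.inv_hom_id_assoc,
    ← actionUnitIso_hom_naturality_assoc, μₗ_unitality, ← h₁, δₗ_unitality_inv]
  simp only [coshiftedFamily, Category.assoc, actionHomRight_comp, ← reassoc_of% hν,
    ← G.map_comp_assoc, Iso.hom_inv_id, G.map_id, Category.id_comp]

lemma coshiftedFamily_tensor
    (hν : ∀ {m m' : M} (f : m ⟶ m'), G.map f ≫ ν m' = ν m ≫ x ⊴ₗ F.map f) (c c' : C) (m : M) :
    (αₗ c c' (G.obj m)).inv ≫ coshiftedFamily ν (c ⊗ c') m =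
      c ⊴ₗ μₗ G c' m ≫ coshiftedFamily ν c (c' ⊙ₗ m) ≫ (x ⊗ c) ⊴ₗ δₗ F c' m ≫
        (αₗ (x ⊗ c) c' (F.obj m)).inv ≫ (α_ x c c').hom ⊵ₗ F.obj m := by
  have p : (αₗ x c _).inv ≫ (αₗ (x ⊗ c) c' (F.obj m)).inv ≫ (α_ x c c').hom ⊵ₗ F.obj m =
      x ⊴ₗ (αₗ c c' (F.obj m)).inv ≫ (αₗ x (c ⊗ c') (F.obj m)).inv := by
    rw [← cancel_mono (αₗ x (c ⊗ c') (F.obj m)).hom, ← cancel_mono (x ⊴ₗ (αₗ c c' (F.obj m)).hom)]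
    simp only [Category.assoc, associator_actionHom]
    simp
  rw [← cancel_epi (αₗ c c' (G.obj m)).hom, Iso.hom_inv_id_assoc]
  have q : μₗ G (c ⊗ c') m = (αₗ c c' (G.obj m)).hom ≫ c ⊴ₗ μₗ G c' m ≫ μₗ G c (c' ⊙ₗ m) ≫
      G.map (αₗ c c' m).inv := by
    rw [← reassoc_of% (μₗ_associativity G c c' m), ← G.map_comp, Iso.hom_inv_id, G.map_id,
      Category.comp_id]
  have r : F.map (αₗ c c' m).inv ≫ δₗ F (c ⊗ c') m = δₗ F c (c' ⊙ₗ m) ≫ c ⊴ₗ δₗ F c' m ≫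
      (αₗ c c' (F.obj m)).inv := by
    rw [← cancel_mono (αₗ c c' (F.obj m)).hom]
    simp only [Category.assoc, δₗ_associativity, Iso.inv_hom_id, Category.comp_id,
      ← F.map_comp_assoc, F.map_id, Category.id_comp]
  simp only [coshiftedFamily, Category.assoc, q, reassoc_of% hν, tensor_actionHomRight,
    Iso.inv_hom_id_assoc, p]
  simp only [← actionHomRight_comp_assoc, r]

end

namespace IsUniversalCoev

variable {h : C} {η : ∀ m, G.obj m ⟶ h ⊙ₗ F.obj m} (hη : IsUniversalCoev F G η)

include hη

variable [RigidCategory C]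

/-- The object of a universal family of morphisms `G(m) ⟶ h.F(m)` between module functors has a
unique half-braiding for which the family is compatible with the module structures. -/
theorem existsUnique_halfBraiding : ∃! b : HalfBraiding h, IsModuleConat F G b η := by
  -- These `β c : c ⊗ h ⟶ h ⊗ c` are the prospective inverses of the half-braiding.
  choose β hβ using fun c => hη.exists_tensor_hom (coshiftedFamily η c)
    (coshiftedFamily_naturality hη.naturality c)
  refine ⟨HalfBraiding.ofOplax β ?_ ?_ ?_, (isModuleConat_iff _ _).2 hβ, fun b hb => ?_⟩
  · exact hη.tensor_hom_ext fun m => by rw [hβ, coshiftedFamily_unit hη.naturality]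
  · intro c c'
    refine hη.tensor_hom_ext fun m => ?_
    have p : (αₗ c c' _).inv ≫ (αₗ (c ⊗ c') h (F.obj m)).inv ≫ (α_ c c' h).hom ⊵ₗ F.obj m =
        c ⊴ₗ (αₗ c' h (F.obj m)).inv ≫ (αₗ c (c' ⊗ h) (F.obj m)).inv := by
      rw [← cancel_mono (αₗ c (c' ⊗ h) (F.obj m)).hom,
        ← cancel_mono (c ⊴ₗ (αₗ c' h (F.obj m)).hom)]
      simp only [Category.assoc, associator_actionHom]
      simp
    have q : c ⊴ₗ (αₗ h c' (F.obj m)).inv ≫ (αₗ c (h ⊗ c') (F.obj m)).inv ≫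
        (α_ c h c').inv ⊵ₗ F.obj m ≫ (αₗ (c ⊗ h) c' (F.obj m)).hom = (αₗ c h _).inv := by
      rw [← cancel_mono (αₗ c h _).hom, Iso.inv_hom_id]
      simp only [Category.assoc]
      rw [← associator_actionHom, inv_hom_actionHomLeft_assoc]
      simp
    have e := congrArg (fun t => c ⊴ₗ t) (hβ c' m)
    simp only [coshiftedFamily, actionHomRight_comp] at e
    have r := action_exchange (β c) (δₗ F c' m)
    simp only [tensor_actionHomRight, Category.assoc] at r
    rw [hβ, ← cancel_epi (αₗ c c' (G.obj m)).inv, coshiftedFamily_tensor hη.naturality, ← hβ c]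
    simp only [comp_actionHomLeft, tensor_actionHomRight, Category.assoc, Iso.inv_hom_id_assoc]
    rw [reassoc_of% p, whiskerLeft_actionHomLeft_assoc, Iso.inv_hom_id_assoc, reassoc_of% e,
      whiskerRight_actionHomLeft, Category.assoc, reassoc_of% q,
      ← reassoc_of% r, Iso.inv_hom_id_assoc, Category.assoc]
  · intro c c' f
    refine hη.tensor_hom_ext fun m => ?_
    have e : c ⊴ₗ η m ≫ (αₗ c h _).inv ≫ (f ▷ h) ⊵ₗ F.obj m =
        f ⊵ₗ G.obj m ≫ c' ⊴ₗ η m ≫ (αₗ c' h _).inv := by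
      rw [whiskerRight_actionHomLeft, Iso.inv_hom_id_assoc, action_exchange_assoc]
    rw [comp_actionHomLeft, comp_actionHomLeft, reassoc_of% hβ c,
      ← coshiftedFamily_naturality_left hη.naturality, reassoc_of% e, hβ]
  · refine HalfBraiding.ext_hom fun c => ?_
    suffices b.β c = (HalfBraiding.ofOplax β _ _ _).β c by rw [this]
    refine Iso.ext_inv (hη.tensor_hom_ext fun m => ?_)
    rw [(isModuleConat_iff _ _).1 hb]
    exact (hβ c m).symm

/-- A universal family is also universal in the Drinfeld center. -/
lemma isModuleConat_comp_iff {b : HalfBraiding h} (hb : IsModuleConat F G b η) {x : C}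
    (b' : HalfBraiding x) (f : h ⟶ x) :
    IsModuleConat F G b' (fun m => η m ≫ f ⊵ₗ F.obj m) ↔
      ∀ c, f ▷ c ≫ (b'.β c).hom = (b.β c).hom ≫ c ◁ f := by
  have e (c : C) (m : M) : coshiftedFamily η c m ≫ (f ▷ c) ⊵ₗ F.obj m =
      coshiftedFamily (fun m => η m ≫ f ⊵ₗ F.obj m) c m := by
    simp only [coshiftedFamily, whiskerRight_actionHomLeft, Category.assoc,
      Iso.inv_hom_id_assoc, action_exchange_assoc]
  rw [isModuleConat_iff] at hb ⊢
  refine forall_congr' fun c => ?_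
  -- Compatibility with the half-braidings is restated for their inverses, so that both sides start
  -- at `c ⊗ h`.
  rw [← Iso.eq_comp_inv, Category.assoc, ← Iso.inv_comp_eq, eq_comm]
  refine ⟨fun h' => hη.tensor_hom_ext fun m => ?_, fun h' m => ?_⟩
  · have := h' m
    rw [← e, ← hb] at this
    simpa using this
  · have := congrArg (fun t => c ⊴ₗ η m ≫ (αₗ c h _).inv ≫ t ⊵ₗ F.obj m) h'
    rw [← e, ← hb]
    simpa using this

end IsUniversalCoev

end HalfBraiding

end UniversalCoev

/-! ### Coends of internal coHoms and central integration -/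

namespace InternalCohom

variable {C : Type u₁} [Category.{v₁} C] [MonoidalCategory C]
  {N : Type u₃} [Category.{v₃} N] [MonoidalLeftAction C N] (H : InternalCohom C N)

section

variable [RigidCategory C]

lemma rightModuleIso_hom_comp {c γ : C} {m' m : N} (p : H.icohom (c ⊙ₗ m') m ⟶ γ) :
    (H.rightModuleIso c m' m).hom ≫ p =
      (tensorRightHomEquiv (H.icohom m' m) (ᘁc : C) c γ).symm
        ((H.homEquiv m' m (γ ⊗ c)).symm (H.homEquiv _ _ _ p ≫ (αₗ γ c m').inv)) := by
  rw [rightModuleIso, isoOfHomFromEquiv_hom]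
  apply (tensorRightHomEquiv (H.icohom m' m) (ᘁc : C) c γ).injective
  rw [tensorRightHomEquiv_naturality]
  simp [← homEquiv_symm_naturality, H.homEquiv_eq p]

lemma leftModuleIso_hom_comp {c γ : C} {m' m : N} (p : H.icohom m' (c ⊙ₗ m) ⟶ γ) :
    (H.leftModuleIso c m' m).hom ≫ p =
      (tensorLeftHomEquiv (H.icohom m' m) (ᘁc : C) c γ).symm
        ((H.homEquiv m' m ((ᘁc : C) ⊗ γ)).symm
          (actionHomEquiv (ᘁc : C) c _ _ (H.homEquiv _ _ _ p) ≫ (αₗ (ᘁc : C) γ m').inv)) := by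
  rw [leftModuleIso, isoOfHomFromEquiv_hom]
  apply (tensorLeftHomEquiv (H.icohom m' m) (ᘁc : C) c γ).injective
  rw [tensorLeftHomEquiv_naturality]
  simp [← homEquiv_symm_naturality, H.homEquiv_eq p, actionHomEquiv_comp]

lemma tensor_hom_injective {x c : C} {m' m : N} {p p' : c ⊗ H.icohom m' m ⟶ x} :
    p = p' ↔ c ⊴ₗ H.coev m' m ≫ (αₗ c _ m').inv ≫ p ⊵ₗ m' =
      c ⊴ₗ H.coev m' m ≫ (αₗ c _ m').inv ≫ p' ⊵ₗ m' := by
  rw [← (tensorLeftHomEquiv _ (ᘁc : C) c x).apply_eq_iff_eq,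
    ← (H.homEquiv m' m _).apply_eq_iff_eq, H.homEquiv_eq, H.homEquiv_eq,
    comp_tensorLeftHomEquiv_action, comp_tensorLeftHomEquiv_action, cancel_mono,
    EmbeddingLike.apply_eq_iff_eq]

lemma coev_comp_tensorLeftHomEquiv_symm {x c : C} {m' m : N} (u : c ⊙ₗ m ⟶ x ⊙ₗ m') :
    c ⊴ₗ H.coev m' m ≫ (αₗ c _ m').inv ≫
      (tensorLeftHomEquiv (H.icohom m' m) (ᘁc : C) c x).symm ((H.homEquiv _ _ _).symm
        (actionHomEquiv (ᘁc : C) c _ _ u ≫ (αₗ (ᘁc : C) x m').inv)) ⊵ₗ m' = u := by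
  apply (actionHomEquiv (ᘁc : C) c _ _).injective
  rw [← cancel_mono (αₗ (ᘁc : C) x m').inv, ← comp_tensorLeftHomEquiv_action,
    Equiv.apply_symm_apply, ← homEquiv_eq, Equiv.apply_symm_apply]

end

open Functor.LaxLeftLinear Functor.OplaxLeftLinear Functor.LeftLinear

variable {M : Type u₂} [Category.{v₂} M]

/-- Transposition identifies cowedges with vertex `x` and natural families `G(m) ⟶ x.F(m)`. -/
lemma cowedge_condition_iff {F G : M ⥤ N} {x : C} (p : ∀ m, H.icohom (F.obj m) (G.obj m) ⟶ x)
    {m m' : M} (f : m ⟶ m') :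
    ((H.pullback F G).map f.op).app m ≫ p m = ((H.pullback F G).obj (op m')).map f ≫ p m' ↔
      G.map f ≫ H.homEquiv _ _ _ (p m') = H.homEquiv _ _ _ (p m) ≫ x ⊴ₗ F.map f := by
  rw [← H.homEquiv_map_comp, ← H.homEquiv_map_op_comp, EmbeddingLike.apply_eq_iff_eq,
    eq_comm]
  rfl

lemma hasCoend_of_isUniversalCoev {F G : M ⥤ N} {h : C} {η : ∀ m, G.obj m ⟶ h ⊙ₗ F.obj m}
    (hη : IsUniversalCoev F G η) : HasCoend (H.pullback F G) := by
  let W : Cowedge (H.pullback F G) := Cowedge.mk h (fun m => (H.homEquiv _ _ _).symm (η m))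
    (fun m m' f => (H.cowedge_condition_iff (fun m => (H.homEquiv _ _ _).symm (η m)) f).2
      (by simpa using hη.naturality f))
  choose l hl using fun s : Cowedge (H.pullback F G) => (hη.existsUnique s.pt
    (fun m => H.homEquiv _ _ _ (s.π m)) (fun f => (H.cowedge_condition_iff _ f).1
      (s.condition f))).exists
  have hι {x : C} (f : h ⟶ x) (m : M) (p : H.icohom (F.obj m) (G.obj m) ⟶ x) :
      (H.homEquiv _ _ _).symm (η m) ≫ f = p ↔ η m ≫ f ⊵ₗ F.obj m = H.homEquiv _ _ _ p := by
    rw [← H.homEquiv_symm_naturality, Equiv.symm_apply_eq]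
  exact ⟨⟨W, Multicofork.IsColimit.mk W l (fun s m => (hι _ m _).2 (hl s m)) (fun s f hf =>
    hη.hom_ext fun m => ((hι _ m _).1 (hf m)).trans (hl s m).symm)⟩⟩

lemma isUniversalCoev_coend {F G : M ⥤ N} [HasCoend (H.pullback F G)] :
    IsUniversalCoev F G fun m => H.homEquiv (F.obj m) (G.obj m) _
      (coend.ι (H.pullback F G) m) where
  naturality f := (H.cowedge_condition_iff _ f).1 (coend.condition _ f)
  existsUnique x ν hν := by
    refine ⟨coend.desc (F := H.pullback F G) (fun m => (H.homEquiv _ _ _).symm (ν m))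
      (fun m m' f => (H.cowedge_condition_iff (fun m => (H.homEquiv _ _ _).symm (ν m)) f).2
        (by simpa using hν f)), fun m => ?_, fun f hf => ?_⟩
    · rw [← H.homEquiv_naturality, coend.ι_desc, Equiv.apply_symm_apply]
    · refine coend.hom_ext fun m => ?_
      rw [coend.ι_desc, ← hf m, H.homEquiv_symm_naturality, Equiv.symm_apply_apply]

variable [MonoidalLeftAction C M] [RigidCategory C]

lemma pullbackBimoduleIso_hom_comp {F G : M ⥤ N} [F.LeftLinear C] [G.LeftLinear C] {x : C}
    (i : ∀ m, H.icohom (F.obj m) (G.obj m) ⟶ x) (c : C) (m : M) :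
    (H.pullbackBimoduleIso F G c c m m).hom ≫ i (c ⊙ₗ m) =
      (tensorRightHomEquiv (c ⊗ H.icohom (F.obj m) (G.obj m)) (ᘁc : C) c x).symm
        ((tensorLeftHomEquiv (H.icohom (F.obj m) (G.obj m)) (ᘁc : C) c (x ⊗ c)).symm
          ((H.homEquiv _ _ _).symm (actionHomEquiv (ᘁc : C) c _ _
            (coshiftedFamily (fun m => H.homEquiv (F.obj m) (G.obj m) _ (i m)) c m) ≫
              (αₗ (ᘁc : C) (x ⊗ c) (F.obj m)).inv))) := by
  change (((H.leftModuleIso c (F.obj m) (G.obj m)).hom ▷ (ᘁc : C) ≫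
    (H.rightModuleIso c (F.obj m) (c ⊙ₗ G.obj m)).hom) ≫
      ((H.cohom.map (δₗ F c m).op).app (c ⊙ₗ G.obj m) ≫
        (H.cohom.obj (op (F.obj (c ⊙ₗ m)))).map (μₗ G c m))) ≫ i (c ⊙ₗ m) = _
  rw [Category.assoc, Category.assoc, rightModuleIso_hom_comp,
    ← tensorRightHomEquiv_symm_naturality, leftModuleIso_hom_comp, Equiv.apply_symm_apply,
    Category.assoc, homEquiv_map_op_comp, homEquiv_map_comp]
  simp only [coshiftedFamily, Category.assoc]

lemma isCentralCoend_iff {F G : M ⥤ N} [F.LeftLinear C] [G.LeftLinear C] {h : C}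
    (i : ∀ m, H.icohom (F.obj m) (G.obj m) ⟶ h) (b : HalfBraiding h) :
    IsCentralCoend (H.pullbackBimoduleIso F G) i b ↔
      IsModuleConat F G b fun m => H.homEquiv _ _ _ (i m) := by
  rw [isModuleConat_iff]
  refine forall₂_congr fun c m => ?_
  rw [pullbackBimoduleIso_hom_comp, centralAction]
  refine (Eq.congr_left (tensorRightHomEquiv_symm_naturality _ _).symm).trans ?_
  refine (Equiv.apply_eq_iff_eq _).trans ?_
  refine (H.tensor_hom_injective (p := c ◁ i m ≫ (b.β c).inv)).trans ?_
  rw [coev_comp_tensorLeftHomEquiv_symm, homEquiv_eq]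
  simp

end InternalCohom

/-! ### Uniqueness of representing objects -/

section Comparison

variable {C : Type u₁} [Category.{v₁} C] [MonoidalCategory C]
  {M : Type u₂} [Category.{v₂} M] [MonoidalLeftAction C M]

/-- Yoneda: both objects represent `c ↦ Hom(c.m, m')`. The isomorphism is the factorization of `ev`
through `ε`, and the condition at the identity already determines it. -/
lemma InternalHom.existsUnique_iso (H : InternalHom C M) {m m' : M} {R : C} {ε : R ⊙ₗ m ⟶ m'}
    (hε : ∀ (c : C) (f : c ⊙ₗ m ⟶ m'), ∃! g : c ⟶ R, g ⊵ₗ m ≫ ε = f) :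
    ∃! e : H.ihom m m' ≅ R, ∀ (c : C) (f : c ⟶ H.ihom m m'),
      (f ≫ e.hom) ⊵ₗ m ≫ ε = (H.homEquiv c m m').symm f := by
  obtain ⟨t, ht, -⟩ := hε _ (H.ev m m')
  refine ⟨⟨t, H.homEquiv _ _ _ ε, ?_, ?_⟩, fun c f => ?_, fun e he => ?_⟩
  · rw [← H.homEquiv_naturality, ht, Equiv.apply_symm_apply]
  · refine (hε _ ε).unique ?_ (by simp)
    rw [comp_actionHomLeft, Category.assoc, ht, ← H.homEquiv_symm_eq, Equiv.symm_apply_apply]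
  · rw [comp_actionHomLeft, Category.assoc, ht, ← H.homEquiv_symm_eq]
  · ext
    refine (hε _ (H.ev m m')).unique ?_ ht
    simpa using he _ (𝟙 _)

lemma InternalCohom.existsUnique_iso (H : InternalCohom C M) {m' m : M} {R : C}
    {η : m ⟶ R ⊙ₗ m'} (hη : ∀ (c : C) (f : m ⟶ c ⊙ₗ m'), ∃! g : R ⟶ c, η ≫ g ⊵ₗ m' = f) :
    ∃! e : R ≅ H.icohom m' m, ∀ (c : C) (f : H.icohom m' m ⟶ c),
      η ≫ (e.hom ≫ f) ⊵ₗ m' = H.homEquiv m' m c f := by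
  obtain ⟨t, ht, -⟩ := hη _ (H.coev m' m)
  refine ⟨⟨t, (H.homEquiv _ _ _).symm η, ?_, ?_⟩, fun c f => ?_, fun e he => ?_⟩
  · refine (hη _ η).unique ?_ (by simp)
    rw [comp_actionHomLeft, reassoc_of% ht, ← H.homEquiv_eq, Equiv.apply_symm_apply]
  · rw [← H.homEquiv_symm_naturality, ht, Equiv.symm_apply_apply]
  · rw [comp_actionHomLeft, reassoc_of% ht, ← H.homEquiv_eq]
  · ext
    refine (hη _ (H.coev m' m)).unique ?_ ht
    simpa using he _ (𝟙 _)

lemma InternalHom.comp_eq_homEquiv_iff (H : InternalHom C M) {x y : C} {m m' : M} (t : x ⟶ y)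
    (p : y ⟶ H.ihom m m') (u : x ⊙ₗ m ⟶ m') :
    t ≫ p = H.homEquiv x m m' u ↔ t ⊵ₗ m ≫ (H.homEquiv y m m').symm p = u := by
  rw [← H.homEquiv_symm_naturality, Equiv.symm_apply_eq]

lemma InternalCohom.comp_eq_homEquiv_symm_iff (H : InternalCohom C M) {x y : C} {m' m : M}
    (p : H.icohom m' m ⟶ y) (t : y ⟶ x) (u : m ⟶ x ⊙ₗ m') :
    p ≫ t = (H.homEquiv m' m x).symm u ↔ H.homEquiv m' m y p ≫ t ⊵ₗ m' = u := by
  rw [← H.homEquiv_naturality, Equiv.eq_symm_apply]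

end Comparison

/-! ### Representability over the Drinfeld center -/

namespace RexModuleFunctor

variable {k : Type w} [Field k] {C : Type u₁} [Category.{v₁} C] [MonoidalCategory C]
  {M : Type u₂} [Category.{v₂} M] [Preadditive M] [Linear k M] [MonoidalLeftAction C M]
  {N : Type u₃} [Category.{v₃} N] [Preadditive N] [Linear k N] [MonoidalLeftAction C N]
  [Preadditive C] [Linear k C] [IsFiniteModuleCategory k C N] {F G : RexModuleFunctor k C M N}

/-- The morphism `(x, b).F ⟶ G` given by a natural family compatible with the module
structures. -/
def homOfEv {x : C} {b : HalfBraiding x} {ν : ∀ m, x ⊙ₗ F.functor.obj m ⟶ G.functor.obj m}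
    (hν : ∀ {m m' : M} (f : m ⟶ m'), x ⊴ₗ F.functor.map f ≫ ν m' = ν m ≫ G.functor.map f)
    (hb : IsModuleNat F.functor G.functor b ν) : centerMk x b ⊙ₗ F ⟶ G where
  nat := { app := ν, naturality := fun _ _ f => hν f }
  comm := hb

/-- The morphism `G ⟶ (x, b).F` given by a natural family compatible with the module
structures. -/
def homOfCoev {x : C} {b : HalfBraiding x} {ν : ∀ m, G.functor.obj m ⟶ x ⊙ₗ F.functor.obj m}
    (hν : ∀ {m m' : M} (f : m ⟶ m'), G.functor.map f ≫ ν m' = ν m ≫ x ⊴ₗ F.functor.map f)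
    (hb : IsModuleConat F.functor G.functor b ν) : G ⟶ centerMk x b ⊙ₗ F where
  nat := { app := ν, naturality := fun _ _ f => hν f }
  comm := hb

variable [RigidCategory C]

/-- Universality in `C` supplies the underlying morphism. Because `f` is a module transformation,
`isModuleNat_comp_iff` makes that morphism one of the center. -/
theorem existsUnique_homOfEv {g : C} {b : HalfBraiding g}
    {ε : ∀ m, g ⊙ₗ F.functor.obj m ⟶ G.functor.obj m}
    (hε : IsUniversalEv F.functor G.functor ε) (hb : IsModuleNat F.functor G.functor b ε)
    (z : Center C) (f : z ⊙ₗ F ⟶ G) :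
    ∃! t : z ⟶ centerMk g b, t ⊵ₗ F ≫ homOfEv hε.naturality hb = f := by
  obtain ⟨x, b'⟩ := z
  obtain ⟨t, ht, -⟩ := hε.existsUnique x (fun m => f.nat.app m) (fun u => f.nat.naturality u)
  have hf : IsModuleNat F.functor G.functor b' fun m => t ⊵ₗ F.functor.obj m ≫ ε m := by
    rw [funext ht]
    exact f.comm
  refine ⟨⟨t, (hε.isModuleNat_comp_iff hb b' t).1 hf⟩, ?_, fun t' ht' => ?_⟩
  · ext m
    exact ht m
  · ext
    refine hε.hom_ext fun m => Eq.trans ?_ (ht m).symm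
    exact congrArg (fun u => (Hom.nat u).app m) ht'

theorem existsUnique_homOfCoev {h : C} {b : HalfBraiding h}
    {η : ∀ m, G.functor.obj m ⟶ h ⊙ₗ F.functor.obj m}
    (hη : IsUniversalCoev F.functor G.functor η) (hb : IsModuleConat F.functor G.functor b η)
    (z : Center C) (f : G ⟶ z ⊙ₗ F) :
    ∃! t : centerMk h b ⟶ z, homOfCoev hη.naturality hb ≫ t ⊵ₗ F = f := by
  obtain ⟨x, b'⟩ := z
  obtain ⟨t, ht, -⟩ := hη.existsUnique x (fun m => f.nat.app m) (fun u => f.nat.naturality u)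
  have hf : IsModuleConat F.functor G.functor b' fun m => η m ≫ t ⊵ₗ F.functor.obj m := by
    rw [funext ht]
    exact f.comm
  refine ⟨⟨t, (hη.isModuleConat_comp_iff hb b' t).1 hf⟩, ?_, fun t' ht' => ?_⟩
  · ext m
    exact ht m
  · ext
    refine hη.hom_ext fun m => Eq.trans ?_ (ht m).symm
    exact congrArg (fun u => (Hom.nat u).app m) ht'

end RexModuleFunctor

/-! ### The theorem -/

open RexModuleFunctor

theorem theorem4p4 (k : Type w) [Field k] [IsAlgClosed k]
    (C : Type u₁) [Category.{v₁} C] [Abelian C] [Linear k C] [MonoidalCategory C]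
    [MonoidalPreadditive C] [MonoidalLinear k C] [RigidCategory C] [IsFiniteTensorCategory k C]
    (M : Type u₂) [Category.{v₂} M] [Abelian M] [Linear k M] [MonoidalLeftAction C M]
    [IsFiniteModuleCategory k C M]
    (N : Type u₃) [Category.{v₃} N] [Abelian N] [Linear k N] [MonoidalLeftAction C N]
    [IsFiniteModuleCategory k C N] :
    -- existence of the internal Homs and coHoms
    (Nonempty (InternalHom C N) ∧
      Nonempty (InternalHom (Center C) (RexModuleFunctor k C M N)) ∧
      Nonempty (InternalCohom C N) ∧
      Nonempty (InternalCohom (Center C) (RexModuleFunctor k C M N))) ∧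
    -- internal natural transformations as an end
    (∀ (H : InternalHom C N) (Nat : InternalHom (Center C) (RexModuleFunctor k C M N))
        (F G : RexModuleFunctor k C M N),
      ∃ (_ : HasEnd (H.pullback F.functor G.functor))
        (b : HalfBraiding (end_ (H.pullback F.functor G.functor))),
        IsCentralEnd (H.pullbackBimoduleIso F.functor G.functor) (end_.π _) b ∧
        (∀ b', IsCentralEnd (H.pullbackBimoduleIso F.functor G.functor) (end_.π _) b' → b' = b) ∧
        ∃! e : Nat.ihom F G ≅ centerMk (end_ (H.pullback F.functor G.functor)) b,
          ∀ (z : Center C) (f : z ⟶ Nat.ihom F G) (m : M),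
            (f ≫ e.hom).f ≫ end_.π (H.pullback F.functor G.functor) m =
              H.homEquiv z.1 (F.functor.obj m) (G.functor.obj m)
                (((Nat.homEquiv z F G).symm f).nat.app m)) ∧
    -- internal co-natural transformations as a coend
    (∀ (H : InternalCohom C N) (coNat : InternalCohom (Center C) (RexModuleFunctor k C M N))
        (F G : RexModuleFunctor k C M N),
      ∃ (_ : HasCoend (H.pullback F.functor G.functor))
        (b : HalfBraiding (coend (H.pullback F.functor G.functor))),
        IsCentralCoend (H.pullbackBimoduleIso F.functor G.functor) (coend.ι _) b ∧
        (∀ b', IsCentralCoend (H.pullbackBimoduleIso F.functor G.functor) (coend.ι _) b' →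
          b' = b) ∧
        ∃! e : centerMk (coend (H.pullback F.functor G.functor)) b ≅ coNat.icohom F G,
          ∀ (z : Center C) (f : coNat.icohom F G ⟶ z) (m : M),
            coend.ι (H.pullback F.functor G.functor) m ≫ (e.hom ≫ f).f =
              (H.homEquiv (F.functor.obj m) (G.functor.obj m) z.1).symm
                ((coNat.homEquiv F G z f).nat.app m)) := by

  obtain ⟨H⟩ := IsFiniteModuleCategory.nonempty_internalHom k C N
  obtain ⟨H'⟩ := H.nonempty_internalCohom
  obtain ⟨P, hP⟩ := IsFiniteLinearCategory.exists_progenerator k M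
  refine ⟨⟨⟨H⟩, InternalHom.nonempty_of_universal fun F G => ?_, ⟨H'⟩,
    InternalCohom.nonempty_of_universal fun F G => ?_⟩, fun H Nat F G => ?_,
    fun H coNat F G => ?_⟩
  · obtain ⟨g, ε, hε⟩ := InternalHom.exists_isUniversalEv hP F.functor G.functor H
    obtain ⟨b, hb, -⟩ := hε.existsUnique_halfBraiding
    exact ⟨centerMk g b, homOfEv hε.naturality hb, existsUnique_homOfEv hε hb⟩
  · obtain ⟨h, η, hη⟩ := InternalCohom.exists_isUniversalCoev hP F.functor G.functor H'
    obtain ⟨b, hb, -⟩ := hη.existsUnique_halfBraiding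
    exact ⟨centerMk h b, homOfCoev hη.naturality hb, existsUnique_homOfCoev hη hb⟩
  · obtain ⟨_, _, hε'⟩ := InternalHom.exists_isUniversalEv hP F.functor G.functor H
    have := H.hasEnd_of_isUniversalEv hε'
    -- The auxiliary universal object only shows that the end exists; from here on the universal
    -- family is that of `end_` itself, for the given `H`.
    have hε := H.isUniversalEv_end (F := F.functor) (G := G.functor)
    obtain ⟨b, hb, hb'⟩ := hε.existsUnique_halfBraiding
    refine ⟨this, b, (H.isCentralEnd_iff _ _).2 hb,
      fun b' h => hb' b' ((H.isCentralEnd_iff _ _).1 h), ?_⟩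
    -- The Yoneda condition is an equality of module transformations. Taken componentwise and
    -- transposed along `H.homEquiv`, it becomes the stated condition on `end_.π`.
    refine (existsUnique_congr fun e => ?_).1
      (Nat.existsUnique_iso (existsUnique_homOfEv hε hb))
    refine forall₂_congr fun z f => ?_
    exact ⟨fun h m => (H.comp_eq_homEquiv_iff (f ≫ e.hom).f _ _).2
        (congrArg (fun u => (Hom.nat u).app m) h),
      fun h => hom_ext fun m => (H.comp_eq_homEquiv_iff (f ≫ e.hom).f _ _).1 (h m)⟩
  · obtain ⟨_, _, hη'⟩ := InternalCohom.exists_isUniversalCoev hP F.functor G.functor H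
    have := H.hasCoend_of_isUniversalCoev hη'
    have hη := H.isUniversalCoev_coend (F := F.functor) (G := G.functor)
    obtain ⟨b, hb, hb'⟩ := hη.existsUnique_halfBraiding
    refine ⟨this, b, (H.isCentralCoend_iff _ _).2 hb,
      fun b' h => hb' b' ((H.isCentralCoend_iff _ _).1 h), ?_⟩
    refine (existsUnique_congr fun e => ?_).1
      (coNat.existsUnique_iso (existsUnique_homOfCoev hη hb))
    refine forall₂_congr fun z f => ?_
    exact ⟨fun h m => (H.comp_eq_homEquiv_symm_iff _ (e.hom ≫ f).f _).2
        (congrArg (fun u => (Hom.nat u).app m) h),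
      fun h => hom_ext fun m => (H.comp_eq_homEquiv_symm_iff _ (e.hom ≫ f).f _).1 (h m)⟩
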